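/- Let $\mathbb S^1=\mathbb R/2\pi\mathbb Z$ with coordinate $\theta$. For $T>0$ and a smooth positive function $f$ on $[0,T]$, let $g=f(t)^2(dt^2+d\theta^2)$ be the corresponding rotationally symmetric conformal metric on $\Sigma=[0,T]\times\mathbb S^1$. The Dirichlet-to-Neumann operator $L_g$ sends $u\in C^\infty(\partial\Sigma)$ to $\partial\hat u/\partial n$, where $\hat u$ is the harmonic extension of $u$ to $(\Sigma,g)$ and $n$ is the outward unit normal; its eigenvalues, repeated according to multiplicity, are the Steklov eigenvalues $0=\sigma_0(g)<\sigma_1(g)\le\sigma_2(g)\le\cdots$. Let $\tilde\sigma_k(g)=\sigma_k(g)\,\ell_g(\partial\Sigma)$ be the $k$-th normalized Steklov eigenvalue, where $\ell_g(\partial\Sigma)$ is the length of $\partial\Sigma$, and let $M_k$ be the supremum of $\tilde\sigma_k(g)$ over all such metrics $g$, with $f$ and $T>0$ both free. (i) The equation $s=\coth s$ has a unique positive root $T_{2,0}(1)$, and for every integer $k\ge 1$ $$M_{2k-1}=\frac{4k\pi}{T_{2,0}(1)}.$$ A metric $g$ as above satisfies $\tilde\sigma_{2k-1}(g)=M_{2k-1}$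 if and only if $f(0)=f(T)$ and $T=\frac2k\,T_{2,0}(1)$. (ii) $M_2=4\pi$, and $\tilde\sigma_2(g)\neq 4\pi$ for every metric $g$ as above. For a sequence of metrics $g_j=f_j(t)^2(dt^2+d\theta^2)$ on $[0,T_j]\times\mathbb S^1$ as above, $\tilde\sigma_2(g_j)\to 4\pi$ if and only if $T_j\to\infty$ and $f_j(0)/f_j(T_j)\to 1$. (iii) For every integer $k\ge2$ the equation $k\tanh(ks/2)=\coth(s/2)$ has a unique positive root $T_{k,1}(1)$, and $$M_{2k}=4k\pi\tanh\left(\frac{k\,T_{k,1}(1)}{2}\right).$$ A metric $g$ as above satisfies $\tilde\sigma_{2k}(g)=M_{2k}$ if and only if $f(0)=f(T)$ and $T=T_{k,1}(1)$. -/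

import Mathlib

open scoped ContDiff Topology

namespace Steklov

noncomputable section

/-- The hyperbolic cotangent (a junk value at `0`, where it is never used). -/
def coth (x : ℝ) : ℝ := Real.cosh x / Real.sinh x

/-- The circle `𝕊¹ = ℝ / 2πℤ`, with coordinate `θ`. -/
abbrev S1 : Type := AddCircle (2 * Real.pi)

/-- `f(t)² (dt² + dθ²)` is a smooth Riemannian metric on the compact cylinder
`Σ = [0, T] × 𝕊¹`: `T > 0`, and `f` is smooth (up to the boundary) and positive on `[0, T]`.
The values of `f` outside `[0, T]` are irrelevant. -/
structure IsRotMetric (T : ℝ) (f : ℝ → ℝ) : Prop where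
  pos_length : 0 < T
  smooth : ContDiffOn ℝ ∞ f (Set.Icc 0 T)
  pos : ∀ t ∈ Set.Icc 0 T, 0 < f t

/-- `w` is smooth on the cylinder `[0, T] × 𝕊¹`, up to the boundary (expressed on the
universal cover `[0, T] × ℝ`). -/
def IsSmoothOnCylinder (T : ℝ) (w : ℝ → S1 → ℝ) : Prop :=
  ContDiffOn ℝ ∞ (fun p : ℝ × ℝ => w p.1 (p.2 : S1)) (Set.Icc 0 T ×ˢ Set.univ)

/-- The Laplace-Beltrami operator of `g = f(t)² (dt² + dθ²)`, at the point `(t, θ)`: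
`Δ_g w = f(t)⁻² (∂_t² w + ∂_θ² w)`. It is used at interior points `0 < t < T`. -/
def laplaceBeltrami (f : ℝ → ℝ) (w : ℝ → S1 → ℝ) (t θ : ℝ) : ℝ :=
  ((f t) ^ 2)⁻¹ *
    (iteratedDeriv 2 (fun s : ℝ => w s (θ : S1)) t +
      iteratedDeriv 2 (fun x : ℝ => w t (x : S1)) θ)

/-- The outward unit normal derivative of `w` along `{0} × 𝕊¹`: the outward unit normal
there is `-f(0)⁻¹ ∂_t`. The `t`-derivative is one-sided. -/
def normalDerivLeft (T : ℝ) (f : ℝ → ℝ) (w : ℝ → S1 → ℝ) (θ : S1) : ℝ :=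
  -((f 0)⁻¹ * derivWithin (fun s : ℝ => w s θ) (Set.Icc 0 T) 0)

/-- The outward unit normal derivative of `w` along `{T} × 𝕊¹`: the outward unit normal
there is `f(T)⁻¹ ∂_t`. The `t`-derivative is one-sided. -/
def normalDerivRight (T : ℝ) (f : ℝ → ℝ) (w : ℝ → S1 → ℝ) (θ : S1) : ℝ :=
  (f T)⁻¹ * derivWithin (fun s : ℝ => w s θ) (Set.Icc 0 T) T

/-- Real functions on `∂Σ = ({0} × 𝕊¹) ⊔ ({T} × 𝕊¹)`: the first component is the function on
`{0} × 𝕊¹`, the second one is the function on `{T} × 𝕊¹`. -/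
abbrev BoundaryFun : Type := (S1 → ℝ) × (S1 → ℝ)

/-- `w` is a harmonic extension of the boundary function `u` to the cylinder, smooth up to the
boundary. -/
structure IsHarmonicExtension (T : ℝ) (f : ℝ → ℝ) (u : BoundaryFun) (w : ℝ → S1 → ℝ) :
    Prop where
  smooth : IsSmoothOnCylinder T w
  harmonic : ∀ t ∈ Set.Ioo 0 T, ∀ θ : ℝ, laplaceBeltrami f w t θ = 0
  left : ∀ θ : S1, w 0 θ = u.1 θ
  right : ∀ θ : S1, w T θ = u.2 θ

/-- The graph of the Dirichlet-to-Neumann operator `L_g` of `g = f(t)² (dt² + dθ²)` on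
`[0, T] × 𝕊¹`: `L_g u = v` means that `v` is the outward normal derivative of the harmonic
extension of `u`. -/
def IsDirichletToNeumann (T : ℝ) (f : ℝ → ℝ) (u v : BoundaryFun) : Prop :=
  ∃ w : ℝ → S1 → ℝ, IsHarmonicExtension T f u w ∧
    v = (normalDerivLeft T f w, normalDerivRight T f w)

/-- `u` is an eigenfunction of the Dirichlet-to-Neumann operator, with eigenvalue `σ`. -/
def IsSteklovEigenfunction (T : ℝ) (f : ℝ → ℝ) (σ : ℝ) (u : BoundaryFun) : Prop :=
  u ≠ 0 ∧ IsDirichletToNeumann T f u (σ • u)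

/-- The number of Steklov eigenvalues that are at most `σ`, counted with multiplicity: the
dimension of the span of the eigenfunctions with eigenvalue `≤ σ` (the direct sum of the
corresponding eigenspaces). -/
def steklovCount (T : ℝ) (f : ℝ → ℝ) (σ : ℝ) : Cardinal :=
  Module.rank ℝ
    (Submodule.span ℝ {u : BoundaryFun | ∃ σ' ≤ σ, IsSteklovEigenfunction T f σ' u})

/-- The `k`-th Steklov eigenvalue `σ_k`, in the list `0 = σ_0 < σ_1 ≤ σ_2 ≤ …` of all
Steklov eigenvalues, repeated according to multiplicity: the least `σ` such that at least
`k + 1` eigenvalues, counted with multiplicity, are `≤ σ`. -/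
def steklovEigenvalue (T : ℝ) (f : ℝ → ℝ) (k : ℕ) : ℝ :=
  sInf {σ : ℝ | ((k + 1 : ℕ) : Cardinal) ≤ steklovCount T f σ}

/-- The length of `∂Σ` for the metric `f(t)² (dt² + dθ²)`. -/
def boundaryLength (T : ℝ) (f : ℝ → ℝ) : ℝ :=
  (∫ _θ in (0 : ℝ)..(2 * Real.pi), f 0) + ∫ _θ in (0 : ℝ)..(2 * Real.pi), f T

/-- The `k`-th normalized Steklov eigenvalue `σ_k(g) L_g(∂Σ)`. -/
def normalizedSteklov (T : ℝ) (f : ℝ → ℝ) (k : ℕ) : ℝ :=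
  steklovEigenvalue T f k * boundaryLength T f

/-- The set of values of the `k`-th normalized Steklov eigenvalue over all rotationally
symmetric conformal metrics `f(t)² (dt² + dθ²)` on all cylinders `[0, T] × 𝕊¹`, `T > 0`. -/
def rotSteklovValues (k : ℕ) : Set ℝ :=
  {x : ℝ | ∃ (T : ℝ) (f : ℝ → ℝ), IsRotMetric T f ∧ x = normalizedSteklov T f k}

end

end Steklov

/-! In dimension two harmonicity is conformally invariant, so the spectrum depends on `f` only
through `f 0` and `f T`. Separation of variables reduces each frequency `ν` to a quadratic equation.
Writing `σ = 2 ρ / (f 0 + f T)`, it becomes `charPoly q T ν ρ = 0` with `q = balance (f 0) (f T)`,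
and the normalized eigenvalue is `4 π ρ`. The normalized spectrum is thus `4 π` times the family of
all `lowRoot q T m` and `highRoot q T m`, `m ∈ ℤ`. `linearIndependent_modeFun` shows that
multiplicities add up, and `mem_span_modeFun` that no other eigenfunctions exist; the problem
becomes one of counting roots below a number.

For `q = 1` the roots are `ν tanh (ν T / 2)` and `ν coth (ν T / 2)`. On the extremal cylinder the
low root of frequency `k` meets the high root of frequency `0` (odd index) or `1` (even index);
these coincidences are the equations `s = coth s` and `k tanh (k s / 2) = coth (s / 2)`.

For the upper bound let `μ` be the common value of these roots and `x` the first frequency (from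
`0`, resp. from `1`) whose high root is at least `μ`. The high roots of smaller frequencies are
below `μ`, so enough roots are counted once the low root of frequency `k - x`, resp. `k + 1 - x`, is
below `μ`. If it is not, the position of `μ` relative to the roots gives `threshold τ r ≤ q ≤
threshold τ y`, where `τ = μ T / 2` and `r`, `y` are the two frequencies divided by `μ`; at `y = 0`
the right-hand side is replaced by its limit `1 / τ`. For small `τ` the left-hand side exceeds `1`;
for larger `τ` the difference of thresholds increases with `τ`, so an estimate at one value of `τ`
suffices. Only the extremal metric survives.

Index two is explicit: `σ₂` comes from the low root of frequency one, `1 / (coth T + √(coth T ^ 2 -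
q))`, which is less than `1` and tends to `1` exactly when `coth T → 1` and `q → 1`. -/

namespace Steklov

/-! ### Trigonometric functions on the circle -/

/-- The real trigonometric system on the circle, indexed by `ℤ`:
`cos (m θ)` for `m ≥ 0` and `sin (m θ)` for `m < 0`. -/
noncomputable def trig (m : ℤ) (θ : S1) : ℝ :=
  if 0 ≤ m then (fourier m θ).re else (fourier m θ).im

theorem fourier_coe_eq (m : ℤ) (x : ℝ) :
    fourier m (x : S1)
      = ((Real.cos (m * x) : ℝ) : ℂ) + ((Real.sin (m * x) : ℝ) : ℂ) * Complex.I := by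
  rw [fourier_coe_apply]
  have h : 2 * (Real.pi : ℂ) * Complex.I * m * x / ((2 * Real.pi : ℝ) : ℂ)
      = ((m * x : ℝ) : ℂ) * Complex.I := by
    have : (Real.pi : ℂ) ≠ 0 := by exact_mod_cast Real.pi_ne_zero
    push_cast
    field_simp
  rw [h, Complex.exp_mul_I]
  push_cast
  ring

theorem re_fourier_coe (m : ℤ) (x : ℝ) : (fourier m (x : S1)).re = Real.cos (m * x) := by
  rw [fourier_coe_eq, Complex.add_re, Complex.ofReal_re, Complex.re_ofReal_mul, Complex.I_re,
    mul_zero, add_zero]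

theorem im_fourier_coe (m : ℤ) (x : ℝ) : (fourier m (x : S1)).im = Real.sin (m * x) := by
  rw [fourier_coe_eq, Complex.add_im, Complex.ofReal_im, Complex.im_ofReal_mul, Complex.I_im,
    mul_one, zero_add]

theorem trig_coe (m : ℤ) (x : ℝ) :
    trig m (x : S1) = if 0 ≤ m then Real.cos (m * x) else Real.sin (m * x) := by
  rw [trig, re_fourier_coe, im_fourier_coe]

theorem contDiff_trig (m : ℤ) : ContDiff ℝ ∞ (fun x : ℝ => trig m (x : S1)) := by
  simp only [trig_coe]
  split_ifs <;> fun_prop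

theorem iteratedDeriv_two_trig (m : ℤ) (x : ℝ) :
    iteratedDeriv 2 (fun x : ℝ => trig m (x : S1)) x = -(m : ℝ) ^ 2 * trig m (x : S1) := by
  simp only [trig_coe]
  have hl (y : ℝ) : HasDerivAt (fun y : ℝ => (m : ℝ) * y) m y := by
    simpa using (hasDerivAt_id y).const_mul (m : ℝ)
  have hc (y : ℝ) : HasDerivAt (fun y : ℝ => Real.cos (m * y)) (-Real.sin (m * y) * m) y :=
    (hl y).cos
  have hs (y : ℝ) : HasDerivAt (fun y : ℝ => Real.sin (m * y)) (Real.cos (m * y) * m) y :=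
    (hl y).sin
  rw [iteratedDeriv_succ, iteratedDeriv_one]
  split_ifs
  · rw [show deriv (fun y : ℝ => Real.cos (m * y)) = fun y => -Real.sin (m * y) * m from
      funext fun y => (hc y).deriv]
    refine (((hs x).neg).mul_const (m : ℝ)).deriv.trans ?_
    ring
  · rw [show deriv (fun y : ℝ => Real.sin (m * y)) = fun y => Real.cos (m * y) * m from
      funext fun y => (hs y).deriv, ((hc x).mul_const (m : ℝ)).deriv]
    ring

theorem integral_cos_int_mul {k : ℤ} (hk : k ≠ 0) :
    ∫ x in (0 : ℝ)..(2 * Real.pi), Real.cos (k * x) = 0 := by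
  have hk' : (k : ℝ) ≠ 0 := by exact_mod_cast hk
  rw [intervalIntegral.integral_comp_mul_left (fun y => Real.cos y) hk', integral_cos]
  have : Real.sin (k * (2 * Real.pi)) = 0 := by
    simpa using Real.sin_periodic.int_mul_eq k
  simp [this]

theorem integral_sin_int_mul (k : ℤ) :
    ∫ x in (0 : ℝ)..(2 * Real.pi), Real.sin (k * x) = 0 := by
  rcases eq_or_ne k 0 with rfl | hk
  · simp
  have hk' : (k : ℝ) ≠ 0 := by exact_mod_cast hk
  rw [intervalIntegral.integral_comp_mul_left (fun y => Real.sin y) hk', integral_sin]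
  have : Real.cos (k * (2 * Real.pi)) = 1 := by
    simp
  simp [this]

theorem integral_trig_mul_trig {m n : ℤ} (h : m ≠ n) :
    ∫ x in (0 : ℝ)..(2 * Real.pi), trig m (x : S1) * trig n (x : S1) = 0 := by
  have ic (k : ℤ) : IntervalIntegrable (fun x : ℝ => Real.cos (k * x)) MeasureTheory.volume
      0 (2 * Real.pi) := by
    apply Continuous.intervalIntegrable; fun_prop
  have is (k : ℤ) : IntervalIntegrable (fun x : ℝ => Real.sin (k * x)) MeasureTheory.volume
      0 (2 * Real.pi) := by
    apply Continuous.intervalIntegrable; fun_prop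
  simp only [trig_coe]
  split_ifs with h1 h2 h2
  · have e (x : ℝ) : Real.cos (m * x) * Real.cos (n * x)
        = 2⁻¹ * (Real.cos ((m - n : ℤ) * x) + Real.cos ((m + n : ℤ) * x)) := by
      push_cast
      rw [sub_mul, add_mul, Real.cos_add, Real.cos_sub]
      ring
    simp only [e]
    rw [intervalIntegral.integral_const_mul, intervalIntegral.integral_add (ic _) (ic _),
      integral_cos_int_mul (by omega), integral_cos_int_mul (by omega)]
    simp
  · have e (x : ℝ) : Real.cos (m * x) * Real.sin (n * x)
        = 2⁻¹ * (Real.sin ((n - m : ℤ) * x) + Real.sin ((n + m : ℤ) * x)) := by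
      push_cast
      rw [sub_mul, add_mul, Real.sin_add, Real.sin_sub]
      ring
    simp only [e]
    rw [intervalIntegral.integral_const_mul, intervalIntegral.integral_add (is _) (is _),
      integral_sin_int_mul, integral_sin_int_mul]
    simp
  · have e (x : ℝ) : Real.sin (m * x) * Real.cos (n * x)
        = 2⁻¹ * (Real.sin ((m - n : ℤ) * x) + Real.sin ((m + n : ℤ) * x)) := by
      push_cast
      rw [sub_mul, add_mul, Real.sin_add, Real.sin_sub]
      ring
    simp only [e]
    rw [intervalIntegral.integral_const_mul, intervalIntegral.integral_add (is _) (is _),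
      integral_sin_int_mul, integral_sin_int_mul]
    simp
  · have e (x : ℝ) : Real.sin (m * x) * Real.sin (n * x)
        = 2⁻¹ * (Real.cos ((m - n : ℤ) * x) - Real.cos ((m + n : ℤ) * x)) := by
      push_cast
      rw [sub_mul, add_mul, Real.cos_add, Real.cos_sub]
      ring
    simp only [e]
    rw [intervalIntegral.integral_const_mul, intervalIntegral.integral_sub (ic _) (ic _),
      integral_cos_int_mul (by omega), integral_cos_int_mul (by omega)]
    simp

theorem integral_trig_mul_self_pos (m : ℤ) :
    0 < ∫ x in (0 : ℝ)..(2 * Real.pi), trig m (x : S1) * trig m (x : S1) := by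
  have hpi := Real.pi_pos
  have hc := (contDiff_trig m).continuous
  refine intervalIntegral.integral_pos (by positivity) (by fun_prop)
    (fun x _ => mul_self_nonneg _) ?_
  by_cases h : 0 ≤ m
  · refine ⟨0, by constructor <;> [exact le_rfl; positivity], ?_⟩
    simp only [trig_coe, h, if_true]
    simp
  · have hm : (m : ℝ) < 0 := by exact_mod_cast not_le.1 h
    have hm1 : (m : ℝ) ≤ -1 := by
      have : m ≤ -1 := by omega
      exact_mod_cast this
    -- At this point `m x = -π / 2`, so the sine is `-1`.
    refine ⟨Real.pi / (2 * -m), ⟨by apply div_nonneg <;> linarith, ?_⟩, ?_⟩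
    · rw [div_le_iff₀ (by linarith)]
      nlinarith
    · simp only [trig_coe, h, if_false]
      have : (m : ℝ) * (Real.pi / (2 * -m)) = -(Real.pi / 2) := by
        have := hm.ne
        field_simp
      rw [this]
      simp

theorem linearIndependent_trig : LinearIndependent ℝ trig := by
  rw [linearIndependent_iff']
  intro s g hg j hj
  have h1 (x : ℝ) : ∑ i ∈ s, g i * (trig i (x : S1) * trig j (x : S1)) = 0 := by
    have := congrFun hg (x : S1)
    simp only [Finset.sum_apply, Pi.smul_apply, smul_eq_mul, Pi.zero_apply] at this
    simp only [← mul_assoc, ← Finset.sum_mul, this, zero_mul]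
  have h2 : ∫ x in (0 : ℝ)..(2 * Real.pi), ∑ i ∈ s, g i * (trig i (x : S1) * trig j (x : S1))
      = 0 := by
    simp [h1]
  rw [intervalIntegral.integral_finsetSum] at h2
  · simp only [intervalIntegral.integral_const_mul] at h2
    rw [Finset.sum_eq_single j (fun i _ hij => by rw [integral_trig_mul_trig hij, mul_zero])
      (fun h => absurd hj h)] at h2
    exact (mul_eq_zero.1 h2).resolve_right (integral_trig_mul_self_pos j).ne'
  · intro i _
    apply Continuous.intervalIntegrable
    have hi := (contDiff_trig i).continuous
    have hj := (contDiff_trig j).continuous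
    fun_prop

/-! ### Separated harmonic functions -/

/-- `sinh (ν t) / ν`, extended by `t` to `ν = 0`. -/
noncomputable def sinhDiv (ν t : ℝ) : ℝ := if ν = 0 then t else Real.sinh (ν * t) / ν

theorem mul_sinhDiv (ν t : ℝ) : ν * sinhDiv ν t = Real.sinh (ν * t) := by
  unfold sinhDiv
  split_ifs with h
  · simp [h]
  · field_simp

@[simp] theorem sinhDiv_zero_right (ν : ℝ) : sinhDiv ν 0 = 0 := by
  simp [sinhDiv]

theorem sinhDiv_neg_left (ν t : ℝ) : sinhDiv (-ν) t = sinhDiv ν t := by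
  simp [sinhDiv, neg_mul, Real.sinh_neg, neg_div_neg_eq]

theorem sinhDiv_pos (ν : ℝ) {t : ℝ} (ht : 0 < t) : 0 < sinhDiv ν t := by
  unfold sinhDiv
  split_ifs with h
  · exact ht
  · rcases lt_or_gt_of_ne h with h | h
    · exact div_pos_of_neg_of_neg (Real.sinh_neg_iff.2 (mul_neg_of_neg_of_pos h ht)) h
    · exact div_pos (Real.sinh_pos_iff.2 (mul_pos h ht)) h

theorem cosh_sq_sub_sinhDiv_sq (ν t : ℝ) :
    Real.cosh (ν * t) ^ 2 - ν ^ 2 * sinhDiv ν t ^ 2 = 1 := by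
  rw [← mul_pow, mul_sinhDiv, Real.cosh_sq]
  ring

theorem hasDerivAt_sinhDiv (ν t : ℝ) : HasDerivAt (sinhDiv ν) (Real.cosh (ν * t)) t := by
  unfold sinhDiv
  by_cases h : ν = 0
  · simpa [h] using hasDerivAt_id' t
  · simp only [h, if_false]
    have := (((hasDerivAt_id t).const_mul ν).sinh).div_const ν
    simpa [h] using this

theorem hasDerivAt_cosh_mul (ν t : ℝ) :
    HasDerivAt (fun t => Real.cosh (ν * t)) (ν ^ 2 * sinhDiv ν t) t := by
  have := ((hasDerivAt_id t).const_mul ν).cosh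
  simp only [id, mul_one] at this
  rw [sq, mul_assoc, mul_sinhDiv, mul_comm]
  exact this

theorem contDiff_sinhDiv (ν : ℝ) : ContDiff ℝ ∞ (sinhDiv ν) := by
  unfold sinhDiv
  split_ifs <;> fun_prop

/-- The harmonic function `(cosh (m t) - c sinh (m t) / m) e_m(θ)` with `e_m` trigonometric. -/
noncomputable def separated (m : ℤ) (c t : ℝ) (θ : S1) : ℝ :=
  (Real.cosh (m * t) - c * sinhDiv m t) * trig m θ

theorem hasDerivAt_separated (m : ℤ) (c t : ℝ) (θ : S1) :
    HasDerivAt (fun s => separated m c s θ)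
      (((m : ℝ) ^ 2 * sinhDiv m t - c * Real.cosh (m * t)) * trig m θ) t :=
  ((hasDerivAt_cosh_mul m t).sub ((hasDerivAt_sinhDiv m t).const_mul c)).mul_const _

theorem isSmoothOnCylinder_separated (m : ℤ) (c T : ℝ) :
    IsSmoothOnCylinder T (separated m c) := by
  unfold IsSmoothOnCylinder separated
  have h1 := contDiff_trig m
  have h2 := contDiff_sinhDiv (m : ℝ)
  apply ContDiff.contDiffOn
  have h3 : ContDiff ℝ ∞ fun p : ℝ × ℝ => trig m (p.2 : S1) := h1.comp contDiff_snd
  have h4 : ContDiff ℝ ∞ fun p : ℝ × ℝ => sinhDiv m p.1 := h2.comp contDiff_fst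
  have h5 : ContDiff ℝ ∞ fun p : ℝ × ℝ => Real.cosh (m * p.1) := by fun_prop
  exact (h5.sub (contDiff_const.mul h4)).mul h3

theorem laplaceBeltrami_separated (f : ℝ → ℝ) (m : ℤ) (c t θ : ℝ) :
    laplaceBeltrami f (separated m c) t θ = 0 := by
  have h1 : iteratedDeriv 2 (fun s : ℝ => separated m c s (θ : S1)) t
      = (m : ℝ) ^ 2 * separated m c t (θ : S1) := by
    rw [iteratedDeriv_succ, iteratedDeriv_one,
      show deriv (fun s : ℝ => separated m c s (θ : S1)) = fun s =>
        ((m : ℝ) ^ 2 * sinhDiv m s - c * Real.cosh (m * s)) * trig m θ from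
      funext fun s => (hasDerivAt_separated m c s θ).deriv]
    have := (((hasDerivAt_sinhDiv m t).const_mul ((m : ℝ) ^ 2)).sub
      ((hasDerivAt_cosh_mul m t).const_mul c)).mul_const (trig m (θ : S1))
    refine this.deriv.trans ?_
    unfold separated
    ring
  have h2 : iteratedDeriv 2 (fun x : ℝ => separated m c t (x : S1)) θ
      = -(m : ℝ) ^ 2 * separated m c t (θ : S1) := by
    unfold separated
    rw [iteratedDeriv_const_mul_field, iteratedDeriv_two_trig]
    ring
  unfold laplaceBeltrami
  rw [h1, h2]
  ring

/-! ### The Steklov spectrum of a mode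

Eigenvalues are written as `σ = 2 ρ / (α + β)`, where `α = f 0` and `β = f T`. -/

/-- The balance `4 α β / (α + β)²` of two positive numbers; it is at most `1`, with equality
exactly if `α = β`. -/
noncomputable def balance (α β : ℝ) : ℝ := 4 * α * β / (α + β) ^ 2

theorem balance_pos {α β : ℝ} (hα : 0 < α) (hβ : 0 < β) : 0 < balance α β := by
  unfold balance; positivity

theorem one_sub_balance {α β : ℝ} (h : α + β ≠ 0) :
    1 - balance α β = ((α - β) / (α + β)) ^ 2 := by
  unfold balance
  field_simp
  ring

theorem balance_le_one {α β : ℝ} (hα : 0 < α) (hβ : 0 < β) : balance α β ≤ 1 := by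
  have := one_sub_balance (add_pos hα hβ).ne'
  nlinarith [sq_nonneg ((α - β) / (α + β))]

theorem balance_eq_one_iff {α β : ℝ} (hα : 0 < α) (hβ : 0 < β) : balance α β = 1 ↔ α = β := by
  have h := (add_pos hα hβ).ne'
  have := one_sub_balance h
  constructor
  · intro hb
    rw [hb, sub_self, eq_comm, sq_eq_zero_iff, div_eq_zero_iff] at this
    rcases this with h' | h'
    · linarith
    · exact absurd h' h
  · rintro rfl
    rw [sub_self, zero_div] at this
    linarith

/-- The square root of the reduced discriminant of `charPoly`. -/
noncomputable def rootDisc (q T ν : ℝ) : ℝ :=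
  √(Real.cosh (ν * T) ^ 2 - q * (ν ^ 2 * sinhDiv ν T ^ 2))

/-- The smaller root of `charPoly`. -/
noncomputable def lowRoot (q T ν : ℝ) : ℝ :=
  ν ^ 2 * sinhDiv ν T / (Real.cosh (ν * T) + rootDisc q T ν)

/-- The larger root of `charPoly`. -/
noncomputable def highRoot (q T ν : ℝ) : ℝ :=
  (Real.cosh (ν * T) + rootDisc q T ν) / (q * sinhDiv ν T)

/-- The characteristic polynomial of the Dirichlet-to-Neumann operator on the modes of
frequency `ν`. -/
noncomputable def charPoly (q T ν ρ : ℝ) : ℝ :=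
  q * sinhDiv ν T * ρ ^ 2 - 2 * Real.cosh (ν * T) * ρ + ν ^ 2 * sinhDiv ν T

/-- In this form the discriminant is visibly at least `1` when `q ≤ 1`, so both roots are real and
distinct at every frequency, zero included. -/
theorem disc_eq (q T ν : ℝ) :
    Real.cosh (ν * T) ^ 2 - q * (ν ^ 2 * sinhDiv ν T ^ 2)
      = 1 + (1 - q) * (ν * sinhDiv ν T) ^ 2 := by
  have := cosh_sq_sub_sinhDiv_sq ν T
  linear_combination this

theorem one_le_disc {q : ℝ} (hq : q ≤ 1) (T ν : ℝ) :
    1 ≤ Real.cosh (ν * T) ^ 2 - q * (ν ^ 2 * sinhDiv ν T ^ 2) := by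
  rw [disc_eq]
  have : 0 ≤ (1 - q) * (ν * sinhDiv ν T) ^ 2 := mul_nonneg (by linarith) (sq_nonneg _)
  linarith

theorem sq_rootDisc {q : ℝ} (hq : q ≤ 1) (T ν : ℝ) :
    rootDisc q T ν ^ 2 = Real.cosh (ν * T) ^ 2 - q * (ν ^ 2 * sinhDiv ν T ^ 2) :=
  Real.sq_sqrt (by linarith [one_le_disc hq T ν])

theorem rootDisc_pos {q : ℝ} (hq : q ≤ 1) (T ν : ℝ) : 0 < rootDisc q T ν :=
  Real.sqrt_pos.2 (by linarith [one_le_disc hq T ν])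

theorem lowRoot_eq {q T : ℝ} (hq : 0 < q) (hq1 : q ≤ 1) (hT : 0 < T) (ν : ℝ) :
    lowRoot q T ν = (Real.cosh (ν * T) - rootDisc q T ν) / (q * sinhDiv ν T) := by
  have hS := sinhDiv_pos ν hT
  have hC := Real.cosh_pos (ν * T)
  have hD := rootDisc_pos hq1 T ν
  have := sq_rootDisc hq1 T ν
  unfold lowRoot
  rw [div_eq_div_iff (by positivity) (by positivity)]
  linear_combination this

theorem charPoly_eq {q T : ℝ} (hq : 0 < q) (hq1 : q ≤ 1) (hT : 0 < T) (ν ρ : ℝ) :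
    charPoly q T ν ρ = q * sinhDiv ν T * ((ρ - lowRoot q T ν) * (ρ - highRoot q T ν)) := by
  have hS := (sinhDiv_pos ν hT).ne'
  have := sq_rootDisc hq1 T ν
  rw [lowRoot_eq hq hq1 hT]
  unfold charPoly highRoot
  field_simp
  linear_combination this

theorem charPoly_eq_zero_iff {q T : ℝ} (hq : 0 < q) (hq1 : q ≤ 1) (hT : 0 < T) (ν ρ : ℝ) :
    charPoly q T ν ρ = 0 ↔ ρ = lowRoot q T ν ∨ ρ = highRoot q T ν := by
  have hS := (sinhDiv_pos ν hT).ne'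
  rw [charPoly_eq hq hq1 hT]
  simp [hS, hq.ne', sub_eq_zero]

theorem lowRoot_lt_highRoot {q T : ℝ} (hq : 0 < q) (hq1 : q ≤ 1) (hT : 0 < T) (ν : ℝ) :
    lowRoot q T ν < highRoot q T ν := by
  have hS := sinhDiv_pos ν hT
  have hD := rootDisc_pos hq1 T ν
  rw [lowRoot_eq hq hq1 hT]
  unfold highRoot
  gcongr
  linarith

theorem lowRoot_nonneg {T : ℝ} (hT : 0 < T) (q ν : ℝ) : 0 ≤ lowRoot q T ν := by
  have hS := sinhDiv_pos ν hT
  have hC := Real.cosh_pos (ν * T)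
  unfold lowRoot rootDisc
  positivity

/-- The roots, indexed by the modes: `false` stands for the smaller root. -/
noncomputable def modeRoot (q T : ℝ) (p : ℤ × Bool) : ℝ :=
  if p.2 then highRoot q T p.1 else lowRoot q T p.1

theorem modeRoot_nonneg {q T : ℝ} (hq : 0 < q) (hq1 : q ≤ 1) (hT : 0 < T) (p : ℤ × Bool) :
    0 ≤ modeRoot q T p := by
  unfold modeRoot
  split_ifs
  · exact (lowRoot_nonneg hT q _).trans (lowRoot_lt_highRoot hq hq1 hT _).le
  · exact lowRoot_nonneg hT q _

theorem charPoly_modeRoot {q T : ℝ} (hq : 0 < q) (hq1 : q ≤ 1) (hT : 0 < T) (p : ℤ × Bool) :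
    charPoly q T p.1 (modeRoot q T p) = 0 := by
  rw [charPoly_eq_zero_iff hq hq1 hT]
  unfold modeRoot
  split_ifs <;> simp

/-- The quotient of the boundary values at the two ends, for a Steklov eigenfunction of
frequency `ν` and eigenvalue `2 ρ / (α + β)`. -/
noncomputable def endRatio (T α β ν ρ : ℝ) : ℝ :=
  Real.cosh (ν * T) - 2 * ρ / (α + β) * α * sinhDiv ν T

/-- The eigenvalue condition at the left end determines the ratio of the right boundary value to the
left one; the condition at the right end determines the inverse ratio by the reflected formula. The
two are compatible exactly when their product is `1`, which is where `charPoly` comes from. -/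
theorem endRatio_mul {T α β : ℝ} (hαβ : α + β ≠ 0) (ν ρ : ℝ) :
    endRatio T α β ν ρ * (Real.cosh (ν * T) - 2 * ρ / (α + β) * β * sinhDiv ν T) - 1
      = sinhDiv ν T * charPoly (balance α β) T ν ρ := by
  have := cosh_sq_sub_sinhDiv_sq ν T
  unfold endRatio charPoly balance
  field_simp
  linear_combination (α + β) ^ 2 * this

theorem endRatio_injective {T α β : ℝ} (hT : 0 < T) (hα : 0 < α) (hβ : 0 < β) (ν : ℝ) :
    Function.Injective (endRatio T α β ν) := by
  intro x y h
  have hS := sinhDiv_pos ν hT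
  unfold endRatio at h
  have h2 : 2 * x / (α + β) * α * sinhDiv ν T = 2 * y / (α + β) * α * sinhDiv ν T := by linarith
  have h3 := mul_right_cancel₀ hα.ne' (mul_right_cancel₀ hS.ne' h2)
  field_simp at h3
  linarith

/-- The boundary values of the separated eigenfunctions. -/
noncomputable def modeFun (T α β : ℝ) (p : ℤ × Bool) : BoundaryFun :=
  (trig p.1, endRatio T α β p.1 (modeRoot (balance α β) T p) • trig p.1)

theorem isSteklovEigenfunction_modeFun {T : ℝ} {f : ℝ → ℝ} (hf : IsRotMetric T f)
    (p : ℤ × Bool) :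
    IsSteklovEigenfunction T f (2 * modeRoot (balance (f 0) (f T)) T p / (f 0 + f T))
      (modeFun T (f 0) (f T) p) := by
  have hT := hf.pos_length
  have hα := hf.pos 0 ⟨le_rfl, hT.le⟩
  have hβ := hf.pos T ⟨hT.le, le_rfl⟩
  have hq := balance_pos hα hβ
  have hq1 := balance_le_one hα hβ
  have hchar := charPoly_modeRoot hq hq1 hT p
  have hmul := endRatio_mul (T := T) (add_pos hα hβ).ne' (p.1 : ℝ) (modeRoot (balance (f 0) (f T)) T p)
  rw [hchar, mul_zero] at hmul
  set ρ := modeRoot (balance (f 0) (f T)) T p with hρ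
  set σ := 2 * ρ / (f 0 + f T) with hσ
  refine ⟨fun h => linearIndependent_trig.ne_zero p.1 (congrArg Prod.fst h),
    -- The constant `σ f(0)` makes the condition at the left end automatic; the one at the right end
    -- then follows from `charPoly = 0`.
    separated p.1 (σ * f 0), ⟨isSmoothOnCylinder_separated _ _ _,
      fun t _ θ => laplaceBeltrami_separated _ _ _ _ _, fun θ => ?_, fun θ => ?_⟩, ?_⟩
  · simp [separated, modeFun]
  · simp only [separated, modeFun, endRatio, Pi.smul_apply, smul_eq_mul, ← hρ, ← hσ]
  · have hd (t : ℝ) (ht : t ∈ Set.Icc 0 T) (θ : S1) :=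
      (hasDerivAt_separated p.1 (σ * f 0) t θ).hasDerivWithinAt.derivWithin
        (uniqueDiffOn_Icc hT t ht)
    refine Prod.ext (funext fun θ => ?_) (funext fun θ => ?_)
    · simp only [normalDerivLeft, hd 0 ⟨le_rfl, hT.le⟩ θ, modeFun, Prod.smul_mk, Pi.smul_apply,
        smul_eq_mul, mul_zero, sinhDiv_zero_right, Real.cosh_zero]
      field_simp
      ring
    · simp only [normalDerivRight, hd T ⟨hT.le, le_rfl⟩ θ, modeFun, Prod.smul_mk, Pi.smul_apply,
        smul_eq_mul, ← hρ]
      have hmain : σ * endRatio T (f 0) (f T) p.1 ρ * f T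
          = (p.1 : ℝ) ^ 2 * sinhDiv p.1 T - σ * f 0 * Real.cosh (p.1 * T) := by
        have hS := (sinhDiv_pos (p.1 : ℝ) hT).ne'
        have hsq := cosh_sq_sub_sinhDiv_sq (p.1 : ℝ) T
        apply mul_left_cancel₀ hS
        unfold endRatio at hmul ⊢
        rw [← hσ] at hmul ⊢
        linear_combination -hmul + hsq
      rw [← hmain]
      field_simp

/-- Independence of `trig` on each boundary circle separates the frequencies; within one frequency
the two functions have different end ratios, because the two roots differ. -/
theorem linearIndependent_modeFun {T α β : ℝ} (hT : 0 < T) (hα : 0 < α) (hβ : 0 < β) :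
    LinearIndependent ℝ (modeFun T α β) := by
  have hq := balance_pos hα hβ
  have hq1 := balance_le_one hα hβ
  rw [linearIndependent_iff'']
  intro s g hgs hsum
  set r : ℤ × Bool → ℝ := fun p => endRatio T α β p.1 (modeRoot (balance α β) T p) with hr
  -- Enlarging the index set to a full product groups the sum by frequency.
  have hsub : s ⊆ s.image Prod.fst ×ˢ (Finset.univ : Finset Bool) := fun p hp =>
    Finset.mem_product.2 ⟨Finset.mem_image_of_mem _ hp, Finset.mem_univ _⟩
  rw [Finset.sum_subset hsub (fun p _ hp => by rw [hgs p hp, zero_smul])] at hsum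
  have h1 : ∑ m ∈ s.image Prod.fst, (g (m, true) + g (m, false)) • trig m = 0 := by
    have := congrArg Prod.fst hsum
    rw [Finset.sum_product, Prod.fst_sum] at this
    simpa [modeFun, add_smul] using this
  have h2 : ∑ m ∈ s.image Prod.fst,
      (g (m, true) * r (m, true) + g (m, false) * r (m, false)) • trig m = 0 := by
    have := congrArg Prod.snd hsum
    rw [Finset.sum_product, Prod.snd_sum] at this
    simpa [modeFun, add_smul, mul_smul, hr] using this
  rintro ⟨m, b⟩
  by_cases hm : m ∈ s.image Prod.fst
  · have e1 := linearIndependent_iff'.1 linearIndependent_trig _ _ h1 m hm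
    have e2 := linearIndependent_iff'.1 linearIndependent_trig _ _ h2 m hm
    have hne : r (m, true) ≠ r (m, false) := by
      intro h
      have := endRatio_injective hT hα hβ m h
      simp only [modeRoot, if_true] at this
      exact (lowRoot_lt_highRoot hq hq1 hT m).ne' (by simpa using this)
    have e3 : g (m, true) * (r (m, true) - r (m, false)) = 0 := by
      linear_combination e2 - r (m, false) * e1
    have e4 := (mul_eq_zero.1 e3).resolve_right (sub_ne_zero.2 hne)
    cases b
    · linarith
    · exact e4
  · exact hgs _ fun h => hm (Finset.mem_image_of_mem Prod.fst h)

/-! ### Fourier coefficients of a harmonic extension -/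

section Strip

variable {T : ℝ}

theorem uniqueDiffOn_strip (hT : 0 < T) :
    UniqueDiffOn ℝ (Set.Icc 0 T ×ˢ (Set.univ : Set ℝ)) :=
  (uniqueDiffOn_Icc hT).prod uniqueDiffOn_univ

/-- The derivative in the first variable, on the closed strip `[0, T] × ℝ`. -/
noncomputable def stripDeriv (T : ℝ) (F : ℝ × ℝ → ℝ) (p : ℝ × ℝ) : ℝ :=
  fderivWithin ℝ F (Set.Icc 0 T ×ˢ Set.univ) p (1, 0)

theorem contDiffOn_stripDeriv (hT : 0 < T) {F : ℝ × ℝ → ℝ}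
    (hF : ContDiffOn ℝ ∞ F (Set.Icc 0 T ×ˢ Set.univ)) :
    ContDiffOn ℝ ∞ (stripDeriv T F) (Set.Icc 0 T ×ˢ Set.univ) :=
  (hF.fderivWithin (uniqueDiffOn_strip hT) (by simp)).clm_apply contDiffOn_const

theorem hasDerivWithinAt_stripDeriv {F : ℝ × ℝ → ℝ}
    (hF : ContDiffOn ℝ ∞ F (Set.Icc 0 T ×ˢ Set.univ)) {t : ℝ} (ht : t ∈ Set.Icc 0 T) (θ : ℝ) :
    HasDerivWithinAt (fun s => F (s, θ)) (stripDeriv T F (t, θ)) (Set.Icc 0 T) t := by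
  have h1 : HasFDerivWithinAt F (fderivWithin ℝ F (Set.Icc 0 T ×ˢ Set.univ) (t, θ))
      (Set.Icc 0 T ×ˢ Set.univ) (t, θ) :=
    ((hF.differentiableOn (by simp)) (t, θ) ⟨ht, trivial⟩).hasFDerivWithinAt
  have h2 : HasDerivWithinAt (fun s : ℝ => (s, θ)) ((1 : ℝ), (0 : ℝ)) (Set.Icc 0 T) t :=
    ((hasDerivAt_id' t).prodMk (hasDerivAt_const t θ)).hasDerivWithinAt
  have h3 : Set.MapsTo (fun s : ℝ => (s, θ)) (Set.Icc 0 T) (Set.Icc 0 T ×ˢ Set.univ) :=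
    fun s hs => ⟨hs, trivial⟩
  exact h1.comp_hasDerivWithinAt t h2 h3

/-- Differentiation under the integral sign up to the ends of `[0, T]`: the integral of `G` is, by
the fundamental theorem and Fubini, a constant plus a primitive of the integral of `G'`. -/
theorem hasDerivWithinAt_integral_strip (hT : 0 < T) {G G' : ℝ × ℝ → ℝ} {e : ℝ → ℂ}
    (hG : ContinuousOn G (Set.Icc 0 T ×ˢ Set.univ))
    (hG' : ContinuousOn G' (Set.Icc 0 T ×ˢ Set.univ)) (he : Continuous e)
    (hd : ∀ t ∈ Set.Icc 0 T, ∀ θ,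
      HasDerivWithinAt (fun s => G (s, θ)) (G' (t, θ)) (Set.Icc 0 T) t) (c : ℝ)
    {t : ℝ} (ht : t ∈ Set.Icc 0 T) :
    HasDerivWithinAt (fun s => ∫ θ in (0 : ℝ)..c, (G (s, θ) : ℂ) * e θ)
      (∫ θ in (0 : ℝ)..c, (G' (t, θ) : ℂ) * e θ) (Set.Icc 0 T) t := by
  -- Projecting onto `[0, T]` extends `G'` continuously to all times, so that two-sided calculus
  -- applies.
  set g : ℝ → ℝ → ℂ := fun s θ => (G' ((Set.projIcc 0 T hT.le s : ℝ), θ) : ℂ) * e θ with hg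
  have hgc : Continuous (Function.uncurry g) := by
    have h1 : Continuous fun p : ℝ × ℝ => G' ((Set.projIcc 0 T hT.le p.1 : ℝ), p.2) :=
      hG'.comp_continuous (by fun_prop) (fun p => ⟨(Set.projIcc 0 T hT.le p.1).2, trivial⟩)
    have h2 : Continuous fun p : ℝ × ℝ => e p.2 := he.comp continuous_snd
    exact (Complex.continuous_ofReal.comp h1).mul h2
  have hgeq {s : ℝ} (hs : s ∈ Set.Icc 0 T) (θ : ℝ) : g s θ = (G' (s, θ) : ℂ) * e θ := by
    simp only [hg, Set.projIcc_of_mem hT.le hs]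
  have hslice {s : ℝ} (hs : s ∈ Set.Icc 0 T) : Continuous fun θ => (G (s, θ) : ℂ) * e θ := by
    refine (Complex.continuous_ofReal.comp ?_).mul he
    exact hG.comp_continuous (by fun_prop) (fun θ => ⟨hs, trivial⟩)
  have hI : Continuous fun s => ∫ θ in (0 : ℝ)..c, g s θ :=
    intervalIntegral.continuous_parametric_intervalIntegral_of_continuous' hgc 0 c
  have hformula {s : ℝ} (hs : s ∈ Set.Icc 0 T) :
      ∫ θ in (0 : ℝ)..c, (G (s, θ) : ℂ) * e θ
        = (∫ θ in (0 : ℝ)..c, (G (0, θ) : ℂ) * e θ) + ∫ r in (0 : ℝ)..s, ∫ θ in (0 : ℝ)..c, g r θ := by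
    rw [MeasureTheory.intervalIntegral_intervalIntegral_swap]
    · rw [← intervalIntegral.integral_add ((hslice ⟨le_rfl, hT.le⟩).intervalIntegrable _ _)]
      · refine intervalIntegral.integral_congr fun θ _ => ?_
        have := intervalIntegral.integral_eq_sub_of_hasDerivAt_of_le (a := 0) (b := s)
          (f := fun r => (G (r, θ) : ℂ) * e θ) (f' := fun r => g r θ) hs.1 ?_ ?_ ?_
        · simp only [this]
          ring
        · refine ContinuousOn.mul (Complex.continuous_ofReal.comp_continuousOn ?_)
            continuousOn_const
          exact hG.comp (by fun_prop) fun r hr => ⟨⟨hr.1, hr.2.trans hs.2⟩, trivial⟩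
        · intro r hr
          have hr' : r ∈ Set.Icc 0 T := ⟨hr.1.le, hr.2.le.trans hs.2⟩
          rw [hgeq hr']
          have := (hd r hr' θ).hasDerivAt (Icc_mem_nhds hr.1 (hr.2.trans_le hs.2))
          exact this.ofReal_comp.mul_const _
        · apply Continuous.intervalIntegrable
          exact hgc.comp (by fun_prop : Continuous fun r : ℝ => (r, θ))
      · apply Continuous.intervalIntegrable
        apply intervalIntegral.continuous_parametric_intervalIntegral_of_continuous'
        exact hgc.comp continuous_swap
    · exact (hgc.continuousOn.integrableOn_compact
        (isCompact_uIcc.prod isCompact_uIcc)).mono_set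
        (Set.prod_mono Set.uIoc_subset_uIcc Set.uIoc_subset_uIcc)
  have hder := (intervalIntegral.integral_hasDerivAt_right (hI.intervalIntegrable 0 t)
    (hI.stronglyMeasurableAtFilter _ _) hI.continuousAt).const_add
      (∫ θ in (0 : ℝ)..c, (G (0, θ) : ℂ) * e θ)
  have := (hder.hasDerivWithinAt (s := Set.Icc 0 T)).congr (fun s hs => hformula hs)
    (hformula ht)
  refine this.congr_deriv ?_
  simp only [hgeq ht]

end Strip

/-- The conjugate exponential `exp (-i n θ)`. -/
noncomputable def conjExp (n : ℤ) (x : ℝ) : ℂ := Complex.exp (-(n * x : ℂ) * Complex.I)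

theorem conjExp_eq_fourier (n : ℤ) (x : ℝ) : conjExp n x = fourier (-n) (x : S1) := by
  rw [fourier_coe_eq, conjExp, Complex.exp_mul_I]
  push_cast
  ring_nf

theorem hasDerivAt_conjExp (n : ℤ) (x : ℝ) :
    HasDerivAt (conjExp n) (-(n : ℂ) * Complex.I * conjExp n x) x := by
  have h1 : HasDerivAt (fun y : ℝ => -(n * y : ℂ) * Complex.I) (-(n : ℂ) * Complex.I) x := by
    have := ((Complex.ofRealCLM.hasDerivAt (x := x)).const_mul (n : ℂ)).neg.mul_const Complex.I
    simpa using this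
  have := h1.cexp
  rw [mul_comm] at this
  exact this

theorem continuous_conjExp (n : ℤ) : Continuous (conjExp n) := by
  unfold conjExp
  fun_prop

theorem conjExp_zero (n : ℤ) : conjExp n 0 = 1 := by simp [conjExp]

theorem conjExp_two_pi (n : ℤ) : conjExp n (2 * Real.pi) = 1 := by
  have : ((2 * Real.pi : ℝ) : S1) = ((0 : ℝ) : S1) := by
    rw [AddCircle.coe_period]; rfl
  rw [conjExp_eq_fourier, this, ← conjExp_eq_fourier, conjExp_zero]

/-- Two integrations by parts, in the form of the single primitive `k' e - k e'`, whose values at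
`0` and `2π` agree by periodicity. -/
theorem integral_iteratedDeriv_mul_conjExp {h : S1 → ℝ}
    (hh : ContDiff ℝ ∞ fun x : ℝ => h (x : S1)) (n : ℤ) :
    ∫ x in (0 : ℝ)..(2 * Real.pi),
        ((iteratedDeriv 2 (fun x : ℝ => h (x : S1)) x : ℝ) : ℂ) * conjExp n x
      = -(n : ℂ) ^ 2 * ∫ x in (0 : ℝ)..(2 * Real.pi), ((h (x : S1) : ℝ) : ℂ) * conjExp n x := by
  set k : ℝ → ℝ := fun x => h (x : S1) with hk
  have hper : Function.Periodic k (2 * Real.pi) := fun x => by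
    simp only [hk, AddCircle.coe_add, AddCircle.coe_period, add_zero]
  have hper' : deriv k (2 * Real.pi) = deriv k 0 := by
    have : (fun x => k (x + 2 * Real.pi)) = k := funext hper
    have h2 := deriv_comp_add_const k (2 * Real.pi) 0
    rw [this, zero_add] at h2
    exact h2.symm
  have hper0 : k (2 * Real.pi) = k 0 := by simpa using hper 0
  have hd1 (x : ℝ) : HasDerivAt k (deriv k x) x :=
    (hh.differentiable (by simp)).differentiableAt.hasDerivAt
  have hk1 : ContDiff ℝ ∞ (deriv k) := hh.iterate_deriv 1
  have hd2 (x : ℝ) : HasDerivAt (deriv k) (deriv (deriv k) x) x :=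
    (hk1.differentiable (by simp)).differentiableAt.hasDerivAt
  have hk2 : Continuous (deriv (deriv k)) := (hh.iterate_deriv 2).continuous
  have hce := continuous_conjExp n
  rw [← intervalIntegral.integral_const_mul, ← sub_eq_zero, ← intervalIntegral.integral_sub]
  · have hF (x : ℝ) : HasDerivAt
        (fun x => ((deriv k x : ℝ) : ℂ) * conjExp n x - ((k x : ℝ) : ℂ) * (-(n : ℂ) * Complex.I * conjExp n x))
        (((iteratedDeriv 2 k x : ℝ) : ℂ) * conjExp n x
          - -(n : ℂ) ^ 2 * (((k x : ℝ) : ℂ) * conjExp n x)) x := by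
      rw [iteratedDeriv_succ, iteratedDeriv_one]
      have h1 := ((hd2 x).ofReal_comp.mul (hasDerivAt_conjExp n x)).sub
        ((hd1 x).ofReal_comp.mul
          ((hasDerivAt_conjExp n x).const_mul (-(n : ℂ) * Complex.I)))
      refine h1.congr_deriv ?_
      linear_combination (n : ℂ) ^ 2 * (k x : ℂ) * conjExp n x * Complex.I_mul_I.symm
    rw [intervalIntegral.integral_eq_sub_of_hasDerivAt (fun x _ => hF x)]
    · rw [hper', hper0, conjExp_two_pi, conjExp_zero, sub_self]
    · apply Continuous.intervalIntegrable
      have h3 := hh.continuous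
      rw [iteratedDeriv_succ, iteratedDeriv_one]
      fun_prop
  · apply Continuous.intervalIntegrable
    rw [iteratedDeriv_succ, iteratedDeriv_one]
    fun_prop
  · apply Continuous.intervalIntegrable
    exact continuous_const.mul ((Complex.continuous_ofReal.comp hh.continuous).mul hce)

/-- The `n`-th Fourier coefficient of a function on the circle, up to the factor `2π`. -/
noncomputable def circleCoeff (n : ℤ) (h : S1 → ℝ) : ℂ :=
  ∫ x in (0 : ℝ)..(2 * Real.pi), ((h (x : S1) : ℝ) : ℂ) * conjExp n x

theorem circleCoeff_const_mul (n : ℤ) (c : ℝ) (h : S1 → ℝ) :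
    circleCoeff n (fun θ => c * h θ) = c * circleCoeff n h := by
  unfold circleCoeff
  rw [← intervalIntegral.integral_const_mul]
  refine intervalIntegral.integral_congr fun x _ => ?_
  push_cast
  ring

/-- Along a harmonic function on the cylinder, Fourier coefficients and those of the normal
derivatives are related as for the solutions of `A'' = n² A`. -/
theorem IsHarmonicExtension.circleCoeff_relations {T : ℝ} {f : ℝ → ℝ} (hf : IsRotMetric T f)
    {u : BoundaryFun} {w : ℝ → S1 → ℝ} (hw : IsHarmonicExtension T f u w) (n : ℤ) :
    circleCoeff n (fun θ => derivWithin (fun s => w s θ) (Set.Icc 0 T) 0) * (sinhDiv n T : ℝ)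
        + circleCoeff n u.1 * (Real.cosh (n * T) : ℝ) = circleCoeff n u.2 ∧
      circleCoeff n u.2 * (Real.cosh (n * T) : ℝ)
        - circleCoeff n (fun θ => derivWithin (fun s => w s θ) (Set.Icc 0 T) T)
          * (sinhDiv n T : ℝ) = circleCoeff n u.1 := by
  have hT := hf.pos_length
  set F : ℝ × ℝ → ℝ := fun p => w p.1 (p.2 : S1) with hF
  have hFs : ContDiffOn ℝ ∞ F (Set.Icc 0 T ×ˢ Set.univ) := hw.smooth
  have hF1 := contDiffOn_stripDeriv hT hFs
  have hF2 := contDiffOn_stripDeriv hT hF1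
  set A : ℝ → ℂ := fun t => ∫ x in (0 : ℝ)..(2 * Real.pi), (F (t, x) : ℂ) * conjExp n x with hA
  set B : ℝ → ℂ := fun t =>
    ∫ x in (0 : ℝ)..(2 * Real.pi), (stripDeriv T F (t, x) : ℂ) * conjExp n x with hB
  have hAd {t : ℝ} (ht : t ∈ Set.Icc 0 T) : HasDerivWithinAt A (B t) (Set.Icc 0 T) t :=
    hasDerivWithinAt_integral_strip hT hFs.continuousOn hF1.continuousOn (continuous_conjExp n)
      (fun t ht θ => hasDerivWithinAt_stripDeriv hFs ht θ) _ ht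
  have hBd {t : ℝ} (ht : t ∈ Set.Icc 0 T) : HasDerivWithinAt B
      (∫ x in (0 : ℝ)..(2 * Real.pi), (stripDeriv T (stripDeriv T F) (t, x) : ℂ) * conjExp n x)
      (Set.Icc 0 T) t :=
    hasDerivWithinAt_integral_strip hT hF1.continuousOn hF2.continuousOn (continuous_conjExp n)
      (fun t ht θ => hasDerivWithinAt_stripDeriv hF1 ht θ) _ ht
  have hAd' {t : ℝ} (ht : t ∈ Set.Ioo 0 T) : HasDerivAt A (B t) t :=
    (hAd (Set.Ioo_subset_Icc_self ht)).hasDerivAt (Icc_mem_nhds ht.1 ht.2)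
  have hBd' {t : ℝ} (ht : t ∈ Set.Ioo 0 T) : HasDerivAt B ((n : ℂ) ^ 2 * A t) t := by
    have ht' := Set.Ioo_subset_Icc_self ht
    refine ((hBd ht').hasDerivAt (Icc_mem_nhds ht.1 ht.2)).congr_deriv ?_
    have hslice : ContDiff ℝ ∞ fun x : ℝ => w t (x : S1) := by
      rw [← contDiffOn_univ]
      exact hFs.comp (g := F) (f := fun x : ℝ => (t, x)) (by fun_prop) fun x _ => ⟨ht', trivial⟩
    have key (x : ℝ) : stripDeriv T (stripDeriv T F) (t, x)
        = -iteratedDeriv 2 (fun x : ℝ => w t (x : S1)) x := by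
      have h1 : iteratedDeriv 2 (fun s : ℝ => w s (x : S1)) t
          = stripDeriv T (stripDeriv T F) (t, x) := by
        rw [iteratedDeriv_succ, iteratedDeriv_one]
        have : deriv (fun s : ℝ => w s (x : S1)) =ᶠ[𝓝 t] fun s => stripDeriv T F (s, x) := by
          filter_upwards [isOpen_Ioo.mem_nhds ht] with s hs
          exact ((hasDerivWithinAt_stripDeriv hFs (Set.Ioo_subset_Icc_self hs) x).hasDerivAt
            (Icc_mem_nhds hs.1 hs.2)).deriv
        rw [this.deriv_eq]
        exact ((hasDerivWithinAt_stripDeriv hF1 ht' x).hasDerivAt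
            (Icc_mem_nhds ht.1 ht.2)).deriv
      have h2 := hw.harmonic t ht x
      unfold laplaceBeltrami at h2
      have h3 := (mul_eq_zero.1 h2).resolve_left
        (inv_ne_zero (pow_ne_zero 2 (hf.pos t ht').ne'))
      rw [h1] at h3
      linarith
    simp only [key, Complex.ofReal_neg, neg_mul, intervalIntegral.integral_neg]
    rw [integral_iteratedDeriv_mul_conjExp hslice]
    simp only [hA, hF]
    ring
  have hAc : ContinuousOn A (Set.Icc 0 T) := fun t ht => (hAd ht).continuousWithinAt
  have hBc : ContinuousOn B (Set.Icc 0 T) := fun t ht => (hBd ht).continuousWithinAt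
  -- `A` and `v` solve the same equation `y'' = n² y`, so their Wronskian has zero derivative inside
  -- the interval and is continuous up to its ends.
  have wronskian {v v' : ℝ → ℝ} (hv : ∀ t, HasDerivAt v (v' t) t)
      (hv' : ∀ t, HasDerivAt v' ((n : ℝ) ^ 2 * v t) t) :
      B T * v T - A T * v' T = B 0 * v 0 - A 0 * v' 0 := by
    have hvc : Continuous v := continuous_iff_continuousAt.2 fun t => (hv t).continuousAt
    have hvc' : Continuous v' := continuous_iff_continuousAt.2 fun t => (hv' t).continuousAt
    have := intervalIntegral.integral_eq_sub_of_hasDerivAt_of_le (a := 0) (b := T)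
      (f := fun t => B t * (v t : ℂ) - A t * (v' t : ℂ)) (f' := fun _ => 0) hT.le
      ((hBc.mul (by fun_prop)).sub (hAc.mul (by fun_prop))) (fun t ht => ?_) (by simp)
    · rw [intervalIntegral.integral_zero] at this
      exact sub_eq_zero.1 this.symm
    · refine (((hBd' ht).mul (hv t).ofReal_comp).sub
        ((hAd' ht).mul (hv' t).ofReal_comp)).congr_deriv ?_
      push_cast
      ring
  have hA0 : A 0 = circleCoeff n u.1 := by simp only [hA, hF, circleCoeff, hw.left]
  have hAT : A T = circleCoeff n u.2 := by simp only [hA, hF, circleCoeff, hw.right]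
  have hBeq {t : ℝ} (ht : t ∈ Set.Icc 0 T) :
      B t = circleCoeff n (fun θ => derivWithin (fun s => w s θ) (Set.Icc 0 T) t) := by
    simp only [hB, circleCoeff]
    congr 1
    funext x
    rw [← (hasDerivWithinAt_stripDeriv hFs ht x).derivWithin (uniqueDiffOn_Icc hT t ht)]
  rw [← hA0, ← hAT, ← hBeq ⟨le_rfl, hT.le⟩, ← hBeq ⟨hT.le, le_rfl⟩]
  constructor
  · have hsub (t : ℝ) : HasDerivAt (fun t => T - t) (-1) t := by
      simpa using (hasDerivAt_id' t).const_sub T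
    -- This solution vanishes at `T`, which removes the unknown derivative there; `sinhDiv n` below
    -- plays the same role at `0`.
    have := wronskian (v := fun t => sinhDiv n (T - t)) (v' := fun t => -Real.cosh (n * (T - t)))
      (fun t => ((hasDerivAt_sinhDiv n (T - t)).comp t (hsub t)).congr_deriv (by ring))
      (fun t => ((hasDerivAt_cosh_mul n (T - t)).comp t (hsub t)).neg.congr_deriv (by ring))
    simp only [sub_self, sub_zero, sinhDiv_zero_right, mul_zero, Real.cosh_zero] at this
    push_cast at this ⊢
    linear_combination -this
  · have := wronskian (v := sinhDiv n) (v' := fun t => Real.cosh (n * t))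
      (hasDerivAt_sinhDiv n) (hasDerivAt_cosh_mul n)
    simp only [sinhDiv_zero_right, mul_zero, Real.cosh_zero] at this
    push_cast at this ⊢
    linear_combination -this

/-! ### Completeness of the separated eigenfunctions and counting of eigenvalues -/

theorem fourierCoeff_ofReal_comp [Fact (0 < 2 * Real.pi)] (h : S1 → ℝ) (n : ℤ) :
    fourierCoeff (fun θ : S1 => (h θ : ℂ)) n = (1 / (2 * Real.pi)) • circleCoeff n h := by
  rw [fourierCoeff_eq_intervalIntegral _ _ 0, zero_add, circleCoeff]
  congr 1
  refine intervalIntegral.integral_congr fun x _ => ?_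
  simp only [conjExp_eq_fourier, smul_eq_mul]
  ring

/-- A continuous function with finitely many nonzero Fourier coefficients is a trigonometric
polynomial. -/
theorem eq_sum_of_circleCoeff {h : S1 → ℝ} (hc : Continuous fun x : ℝ => h (x : S1))
    {N : Finset ℤ} (hN : ∀ n ∉ N, circleCoeff n h = 0) (θ : S1) :
    h θ = (2 * Real.pi)⁻¹ * ∑ n ∈ N, ((circleCoeff n h).re * (fourier n θ).re
      - (circleCoeff n h).im * (fourier n θ).im) := by
  have : Fact (0 < 2 * Real.pi) := ⟨Real.two_pi_pos⟩
  have hcont : Continuous h := isQuotientMap_quotient_mk'.continuous_iff.2 hc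
  set F : C(S1, ℂ) := ⟨fun θ => (h θ : ℂ), Complex.continuous_ofReal.comp hcont⟩ with hF
  have hcoef (n : ℤ) : fourierCoeff F n = (1 / (2 * Real.pi)) • circleCoeff n h :=
    fourierCoeff_ofReal_comp h n
  have hzero : ∀ n ∉ N, fourierCoeff F n = 0 := fun n hn => by
    rw [hcoef, hN n hn, smul_zero]
  have h1 := has_pointwise_sum_fourier_series_of_summable (summable_of_ne_finset_zero hzero) θ
  have h2 : HasSum (fun n => fourierCoeff F n • fourier n θ)
      (∑ n ∈ N, fourierCoeff F n • fourier n θ) :=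
    hasSum_sum_of_ne_finset_zero fun n hn => by rw [hzero n hn, zero_smul]
  have h3 := congrArg Complex.re (h1.unique h2)
  simp only [hcoef, Complex.re_sum] at h3
  rw [Finset.mul_sum]
  refine Eq.trans (Complex.ofReal_re _).symm (h3.trans (Finset.sum_congr rfl fun n _ => ?_))
  rw [Complex.real_smul, smul_eq_mul, mul_assoc, Complex.re_ofReal_mul, Complex.mul_re, one_div]

theorem re_fourier_eq_trig (n : ℤ) : (fun θ : S1 => (fourier n θ).re) = trig |n| := by
  funext θ
  obtain ⟨x, rfl⟩ := QuotientAddGroup.mk_surjective θ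
  rw [trig_coe, if_pos (abs_nonneg n), re_fourier_coe]
  rcases abs_choice n with h | h <;> simp [h]

theorem im_fourier_eq_trig {n : ℤ} (hn : n ≠ 0) :
    (fun θ : S1 => (fourier n θ).im) = (if n < 0 then (1 : ℝ) else -1) • trig (-|n|) := by
  funext θ
  obtain ⟨x, rfl⟩ := QuotientAddGroup.mk_surjective θ
  have hlt : ¬ 0 ≤ -|n| := by
    have := abs_pos.2 hn
    omega
  rw [Pi.smul_apply, trig_coe, if_neg hlt, im_fourier_coe]
  split_ifs with h
  · rw [abs_of_neg h]
    simp
  · rw [abs_of_nonneg (not_lt.1 h)]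
    simp

theorem endRatio_neg (T α β ν ρ : ℝ) : endRatio T α β (-ν) ρ = endRatio T α β ν ρ := by
  simp [endRatio, sinhDiv_neg_left]

theorem modeRoot_neg (q T : ℝ) (m : ℤ) (b : Bool) :
    modeRoot q T (-m, b) = modeRoot q T (m, b) := by
  simp [modeRoot, highRoot, lowRoot, rootDisc, sinhDiv_neg_left]

theorem modeRoot_abs (q T : ℝ) (m : ℤ) (b : Bool) :
    modeRoot q T (|m|, b) = modeRoot q T (m, b) := by
  rcases abs_choice m with h | h <;> simp [h, modeRoot_neg]

theorem endRatio_abs (T α β : ℝ) (m : ℤ) (ρ : ℝ) :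
    endRatio T α β ((|m| : ℤ) : ℝ) ρ = endRatio T α β m ρ := by
  rcases abs_choice m with h | h <;> simp [h, endRatio_neg]

/-- The relations for Fourier coefficients force the `n`-th coefficient to vanish unless `ρ` is a
root of `charPoly` at frequency `n`, and give the right coefficient as `κ n` times the left one.
Finiteness of the set of admissible modes then makes `u` a trigonometric polynomial, without any
convergence question. -/
theorem mem_span_modeFun {T : ℝ} {f : ℝ → ℝ} (hf : IsRotMetric T f) {ρ : ℝ} {u : BoundaryFun}
    (hu : IsSteklovEigenfunction T f (2 * ρ / (f 0 + f T)) u) {P : Finset (ℤ × Bool)}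
    (hP : ∀ p, modeRoot (balance (f 0) (f T)) T p = ρ → p ∈ P) :
    u ∈ Submodule.span ℝ (modeFun T (f 0) (f T) ''
      {p | modeRoot (balance (f 0) (f T)) T p = ρ}) := by
  obtain ⟨-, w, hw, hv⟩ := hu
  have hT := hf.pos_length
  have hα := hf.pos 0 ⟨le_rfl, hT.le⟩
  have hβ := hf.pos T ⟨hT.le, le_rfl⟩
  have hq := balance_pos hα hβ
  have hq1 := balance_le_one hα hβ
  set V := Submodule.span ℝ (modeFun T (f 0) (f T) ''
      {p | modeRoot (balance (f 0) (f T)) T p = ρ}) with hV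
  set κ : ℤ → ℝ := fun n => endRatio T (f 0) (f T) n ρ with hκ
  set σ := 2 * ρ / (f 0 + f T) with hσ
  have hl : (fun θ => derivWithin (fun s => w s θ) (Set.Icc 0 T) 0)
      = fun θ => (-(σ * f 0)) * u.1 θ := by
    funext θ
    have := congrFun (congrArg Prod.fst hv) θ
    simp only [Prod.smul_fst, Pi.smul_apply, smul_eq_mul, normalDerivLeft] at this
    field_simp at this
    linarith
  have hr : (fun θ => derivWithin (fun s => w s θ) (Set.Icc 0 T) T)
      = fun θ => σ * f T * u.2 θ := by
    funext θ
    have := congrFun (congrArg Prod.snd hv) θ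
    simp only [Prod.smul_snd, Pi.smul_apply, smul_eq_mul, normalDerivRight] at this
    field_simp at this
    linarith
  have hrel (n : ℤ) : circleCoeff n u.2 = κ n * circleCoeff n u.1 ∧
      (charPoly (balance (f 0) (f T)) T n ρ = 0 ∨ circleCoeff n u.1 = 0) := by
    obtain ⟨h1, h2⟩ := hw.circleCoeff_relations hf n
    rw [hl, circleCoeff_const_mul] at h1
    rw [hr, circleCoeff_const_mul] at h2
    have e1 : circleCoeff n u.2 = κ n * circleCoeff n u.1 := by
      rw [← h1]
      simp only [hκ, endRatio, ← hσ]
      push_cast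
      ring
    refine ⟨e1, ?_⟩
    have e2 := endRatio_mul (T := T) (add_pos hα hβ).ne' (n : ℝ) ρ
    rw [← hσ] at e2
    have e3 : ((κ n * (Real.cosh (n * T) - σ * f T * sinhDiv n T) - 1 : ℝ) : ℂ)
        * circleCoeff n u.1 = 0 := by
      rw [e1] at h2
      push_cast
      push_cast at h2
      linear_combination h2
    rw [mul_eq_zero, Complex.ofReal_eq_zero, e2, mul_eq_zero] at e3
    exact e3.imp_left fun h => h.resolve_left (sinhDiv_pos _ hT).ne'
  have hroot {n : ℤ} (h : charPoly (balance (f 0) (f T)) T n ρ = 0) :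
      ∃ b, modeRoot (balance (f 0) (f T)) T (n, b) = ρ := by
    rcases (charPoly_eq_zero_iff hq hq1 hT _ _).1 h with h | h
    · exact ⟨false, by simp [modeRoot, h]⟩
    · exact ⟨true, by simp [modeRoot, h]⟩
  have hmem {m : ℤ} {b : Bool} (h : modeRoot (balance (f 0) (f T)) T (m, b) = ρ) :
      ((trig m, κ m • trig m) : BoundaryFun) ∈ V := by
    refine Submodule.subset_span ⟨(m, b), h, ?_⟩
    simp only [modeFun, h, hκ]
  have hmem' {n : ℤ} (h : charPoly (balance (f 0) (f T)) T n ρ = 0) :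
      ((fun θ : S1 => (fourier n θ).re, κ n • fun θ : S1 => (fourier n θ).re) : BoundaryFun) ∈ V ∧
      ((fun θ : S1 => (fourier n θ).im, κ n • fun θ : S1 => (fourier n θ).im) : BoundaryFun)
        ∈ V := by
    obtain ⟨b, hb⟩ := hroot h
    have hκa : κ |n| = κ n := endRatio_abs _ _ _ _ _
    have hκna : κ (-|n|) = κ n := by
      rw [← hκa]
      simp only [hκ, Int.cast_neg, endRatio_neg]
    constructor
    · rw [re_fourier_eq_trig, ← hκa]
      exact hmem (b := b) (by rw [modeRoot_abs, hb])
    -- Frequency zero has no sine function, and `trig (-|0|)` would be the constant `1`, so it is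
    -- treated apart.
    · rcases eq_or_ne n 0 with rfl | hn
      · convert V.zero_mem using 1
        refine Prod.ext ?_ ?_ <;> funext θ <;> simp
      · rw [im_fourier_eq_trig hn, smul_comm, ← Prod.smul_mk, ← hκna]
        exact V.smul_mem _ (hmem (b := b) (by rw [modeRoot_neg, modeRoot_abs, hb]))
  set N := P.image Prod.fst with hN
  have hzero1 : ∀ n ∉ N, circleCoeff n u.1 = 0 := fun n hn =>
    (hrel n).2.resolve_left fun h => by
      obtain ⟨b, hb⟩ := hroot h
      exact hn (Finset.mem_image_of_mem Prod.fst (hP _ hb))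
  have hzero2 : ∀ n ∉ N, circleCoeff n u.2 = 0 := fun n hn => by
    rw [(hrel n).1, hzero1 n hn, mul_zero]
  have hslice {t : ℝ} (ht : t ∈ Set.Icc 0 T) : Continuous fun x : ℝ => w t (x : S1) :=
    hw.smooth.continuousOn.comp_continuous (f := fun x : ℝ => (t, x)) (by fun_prop)
      fun x => ⟨ht, trivial⟩
  have hu1 := eq_sum_of_circleCoeff (h := u.1)
    (by simpa only [hw.left] using hslice ⟨le_rfl, hT.le⟩) hzero1
  have hu2 := eq_sum_of_circleCoeff (h := u.2)
    (by simpa only [hw.right] using hslice ⟨hT.le, le_rfl⟩) hzero2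
  have hsum : u = (2 * Real.pi)⁻¹ • ∑ n ∈ N,
      ((circleCoeff n u.1).re •
        ((fun θ : S1 => (fourier n θ).re, κ n • fun θ : S1 => (fourier n θ).re) : BoundaryFun)
      - (circleCoeff n u.1).im •
        ((fun θ : S1 => (fourier n θ).im, κ n • fun θ : S1 => (fourier n θ).im) :
          BoundaryFun)) := by
    refine Prod.ext (funext fun θ => ?_) (funext fun θ => ?_)
    · rw [hu1 θ, Prod.smul_fst, Prod.fst_sum, Pi.smul_apply, Finset.sum_apply, smul_eq_mul]
      rfl
    · rw [hu2 θ, Prod.smul_snd, Prod.snd_sum, Pi.smul_apply, Finset.sum_apply, smul_eq_mul]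
      congr 1
      refine Finset.sum_congr rfl fun n _ => ?_
      rw [(hrel n).1, Complex.re_ofReal_mul, Complex.im_ofReal_mul]
      simp only [Prod.snd_sub, Prod.smul_snd, Pi.sub_apply, Pi.smul_apply, smul_eq_mul]
      ring
  rw [hsum]
  refine V.smul_mem _ (V.sum_mem fun n _ => ?_)
  rcases (hrel n).2 with h | h
  · exact V.sub_mem (V.smul_mem _ (hmem' h).1) (V.smul_mem _ (hmem' h).2)
  · rw [h]
    simp

/-! ### Eigenvalue counts and bounds in terms of the mode roots. -/

section Count

variable {T : ℝ} {f : ℝ → ℝ}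

theorem card_le_steklovCount (hf : IsRotMetric T f) {ρ : ℝ} {P : Finset (ℤ × Bool)}
    (hP : ∀ p ∈ P, modeRoot (balance (f 0) (f T)) T p ≤ ρ) :
    (P.card : Cardinal) ≤ steklovCount T f (2 * ρ / (f 0 + f T)) := by
  have hT := hf.pos_length
  have hα := hf.pos 0 ⟨le_rfl, hT.le⟩
  have hβ := hf.pos T ⟨hT.le, le_rfl⟩
  have hli := linearIndependent_modeFun hT hα hβ
  have hsub : Submodule.span ℝ (Set.range fun p : P => modeFun T (f 0) (f T) p) ≤
      Submodule.span ℝ {u : BoundaryFun | ∃ σ' ≤ 2 * ρ / (f 0 + f T),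
        IsSteklovEigenfunction T f σ' u} := by
    refine Submodule.span_mono ?_
    rintro _ ⟨p, rfl⟩
    refine ⟨_, ?_, isSteklovEigenfunction_modeFun hf p⟩
    have := hP p p.2
    gcongr
  have hli' : LinearIndependent ℝ fun p : P => modeFun T (f 0) (f T) p :=
    hli.comp _ Subtype.val_injective
  calc (P.card : Cardinal) = Cardinal.mk P := by simp
    _ = Cardinal.mk (Set.range fun p : P => modeFun T (f 0) (f T) p) :=
      (Cardinal.mk_range_eq _ hli'.injective).symm
    _ = _ := (rank_span hli').symm
    _ ≤ _ := Submodule.rank_mono hsub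

theorem steklovCount_le_card (hf : IsRotMetric T f) {ρ : ℝ} {P : Finset (ℤ × Bool)}
    (hP : ∀ p, modeRoot (balance (f 0) (f T)) T p ≤ ρ → p ∈ P) :
    steklovCount T f (2 * ρ / (f 0 + f T)) ≤ (P.card : Cardinal) := by
  have hT := hf.pos_length
  have hα := hf.pos 0 ⟨le_rfl, hT.le⟩
  have hβ := hf.pos T ⟨hT.le, le_rfl⟩
  have hsum := add_pos hα hβ
  have hsub : Submodule.span ℝ {u : BoundaryFun | ∃ σ' ≤ 2 * ρ / (f 0 + f T),
        IsSteklovEigenfunction T f σ' u} ≤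
      Submodule.span ℝ (modeFun T (f 0) (f T) '' (P : Set (ℤ × Bool))) := by
    rw [Submodule.span_le]
    rintro u ⟨σ', hσ', hu⟩
    obtain ⟨ρ', rfl⟩ : ∃ ρ', σ' = 2 * ρ' / (f 0 + f T) :=
      ⟨σ' * (f 0 + f T) / 2, by field_simp⟩
    have hle : ρ' ≤ ρ := by
      rw [div_le_div_iff_of_pos_right hsum] at hσ'
      linarith
    have := mem_span_modeFun hf hu (P := P) fun p hp => hP p (hp.le.trans hle)
    exact Submodule.span_mono (Set.image_mono fun p hp => hP p ((le_of_eq hp).trans hle)) this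
  calc steklovCount T f (2 * ρ / (f 0 + f T)) ≤ _ := Submodule.rank_mono hsub
    _ ≤ Cardinal.mk (modeFun T (f 0) (f T) '' (P : Set (ℤ × Bool))) := rank_span_le _
    _ ≤ Cardinal.mk (P : Set (ℤ × Bool)) := Cardinal.mk_image_le
    _ = _ := by simp

theorem boundaryLength_eq (T : ℝ) (f : ℝ → ℝ) :
    boundaryLength T f = 2 * Real.pi * (f 0 + f T) := by
  simp [boundaryLength]
  ring

theorem steklovEigenvalue_bddBelow (hf : IsRotMetric T f) (k : ℕ) :
    BddBelow {σ : ℝ | ((k + 1 : ℕ) : Cardinal) ≤ steklovCount T f σ} := by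
  have hT := hf.pos_length
  have hα := hf.pos 0 ⟨le_rfl, hT.le⟩
  have hβ := hf.pos T ⟨hT.le, le_rfl⟩
  have hsum := add_pos hα hβ
  refine ⟨0, fun σ hσ => ?_⟩
  by_contra! hneg
  have h := steklovCount_le_card hf (ρ := σ * (f 0 + f T) / 2) (P := ∅) fun p hp => by
    have := modeRoot_nonneg (balance_pos hα hβ) (balance_le_one hα hβ) hT p
    nlinarith
  have he : 2 * (σ * (f 0 + f T) / 2) / (f 0 + f T) = σ := by field_simp
  rw [he] at h
  have := (show ((k + 1 : ℕ) : Cardinal) ≤ steklovCount T f σ from hσ).trans h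
  simp at this

theorem normalizedSteklov_le (hf : IsRotMetric T f) {k : ℕ} {ρ : ℝ} {P : Finset (ℤ × Bool)}
    (hP : ∀ p ∈ P, modeRoot (balance (f 0) (f T)) T p ≤ ρ) (hk : k + 1 ≤ P.card) :
    normalizedSteklov T f k ≤ 4 * Real.pi * ρ := by
  have hT := hf.pos_length
  have hα := hf.pos 0 ⟨le_rfl, hT.le⟩
  have hβ := hf.pos T ⟨hT.le, le_rfl⟩
  have hsum := add_pos hα hβ
  have h1 : steklovEigenvalue T f k ≤ 2 * ρ / (f 0 + f T) := by
    refine csInf_le (steklovEigenvalue_bddBelow hf k) ?_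
    exact le_trans (Nat.cast_le.2 hk) (card_le_steklovCount hf hP)
  have hpi := Real.pi_pos
  rw [normalizedSteklov, boundaryLength_eq]
  calc steklovEigenvalue T f k * (2 * Real.pi * (f 0 + f T))
      ≤ 2 * ρ / (f 0 + f T) * (2 * Real.pi * (f 0 + f T)) := by gcongr
    _ = 4 * Real.pi * ρ := by field_simp; ring

theorem normalizedSteklov_lt (hf : IsRotMetric T f) {k : ℕ} {ρ : ℝ} {P : Finset (ℤ × Bool)}
    (hP : ∀ p ∈ P, modeRoot (balance (f 0) (f T)) T p < ρ) (hk : k + 1 ≤ P.card) :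
    normalizedSteklov T f k < 4 * Real.pi * ρ := by
  have hne : P.Nonempty := Finset.card_pos.1 (by omega)
  -- The largest root over the finite set is still below `ρ`, which preserves strictness despite the
  -- infimum.
  obtain ⟨p, hp, hmax⟩ := P.exists_max_image (modeRoot (balance (f 0) (f T)) T) hne
  have := normalizedSteklov_le hf hmax hk
  have hpi := Real.pi_pos
  refine this.trans_lt ?_
  have := hP p hp
  gcongr

theorem le_normalizedSteklov (hf : IsRotMetric T f) {k : ℕ} {ρ : ℝ} {P : Finset (ℤ × Bool)}
    (hP : ∀ p, modeRoot (balance (f 0) (f T)) T p < ρ → p ∈ P) (hk : P.card ≤ k) :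
    4 * Real.pi * ρ ≤ normalizedSteklov T f k := by
  have hT := hf.pos_length
  have hα := hf.pos 0 ⟨le_rfl, hT.le⟩
  have hβ := hf.pos T ⟨hT.le, le_rfl⟩
  have hsum := add_pos hα hβ
  have h1 : 2 * ρ / (f 0 + f T) ≤ steklovEigenvalue T f k := by
    refine le_csInf ?_ fun σ hσ => ?_
    -- The set under the infimum must be nonempty: any `k + 1` modes provide an element.
    · obtain ⟨Q, hQ⟩ := Infinite.exists_subset_card_eq (ℤ × Bool) (k + 1)
      obtain ⟨p, hp, hmax⟩ := Q.exists_max_image (modeRoot (balance (f 0) (f T)) T)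
        (Finset.card_pos.1 (by omega))
      refine ⟨2 * modeRoot (balance (f 0) (f T)) T p / (f 0 + f T), ?_⟩
      have := card_le_steklovCount hf hmax
      rw [hQ] at this
      exact this
    · by_contra! hlt
      obtain ⟨ρ', rfl⟩ : ∃ ρ', σ = 2 * ρ' / (f 0 + f T) :=
        ⟨σ * (f 0 + f T) / 2, by field_simp⟩
      rw [div_lt_div_iff_of_pos_right hsum] at hlt
      have h2 := (show ((k + 1 : ℕ) : Cardinal) ≤ _ from hσ).trans
        (steklovCount_le_card hf (P := P) fun p hp => hP p (by linarith))
      have h3 : k + 1 ≤ P.card := by exact_mod_cast h2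
      omega
  have hpi := Real.pi_pos
  rw [normalizedSteklov, boundaryLength_eq]
  calc 4 * Real.pi * ρ = 2 * ρ / (f 0 + f T) * (2 * Real.pi * (f 0 + f T)) := by field_simp; ring
    _ ≤ steklovEigenvalue T f k * (2 * Real.pi * (f 0 + f T)) := by gcongr

end Count

/-! ### The hyperbolic cotangent -/

theorem coth_pos {x : ℝ} (hx : 0 < x) : 0 < coth x :=
  div_pos (Real.cosh_pos x) (Real.sinh_pos_iff.2 hx)

theorem one_lt_coth {x : ℝ} (hx : 0 < x) : 1 < coth x := by
  rw [coth, one_lt_div (Real.sinh_pos_iff.2 hx)]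
  exact Real.sinh_lt_cosh x

theorem coth_eq_inv_tanh (x : ℝ) : coth x = (Real.tanh x)⁻¹ := by
  rw [coth, Real.tanh_eq_sinh_div_cosh, inv_div]

theorem hasDerivAt_coth {x : ℝ} (hx : 0 < x) : HasDerivAt coth (-(Real.sinh x ^ 2)⁻¹) x := by
  have hs := (Real.sinh_pos_iff.2 hx).ne'
  refine ((Real.hasDerivAt_cosh x).div (Real.hasDerivAt_sinh x) hs).congr_deriv ?_
  have := Real.cosh_sq x
  field_simp
  linear_combination -this

theorem continuousOn_coth : ContinuousOn coth (Set.Ioi 0) :=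
  fun _ hx => (hasDerivAt_coth hx).continuousAt.continuousWithinAt

theorem strictAntiOn_coth : StrictAntiOn coth (Set.Ioi 0) := by
  refine strictAntiOn_of_deriv_neg (convex_Ioi 0) continuousOn_coth fun x hx => ?_
  rw [interior_Ioi] at hx
  rw [(hasDerivAt_coth hx).deriv]
  have := Real.sinh_pos_iff.2 hx
  simpa using pow_pos this 2

theorem two_mul_coth_two_mul {x : ℝ} (hx : 0 < x) :
    2 * coth (2 * x) = coth x + (coth x)⁻¹ := by
  have hs := (Real.sinh_pos_iff.2 hx).ne'
  have hc := (Real.cosh_pos x).ne'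
  unfold coth
  rw [Real.cosh_two_mul, Real.sinh_two_mul]
  field_simp

theorem sinh_lt_mul_cosh {x : ℝ} (hx : 0 < x) : Real.sinh x < x * Real.cosh x := by
  have hmono : StrictMonoOn (fun x => x * Real.cosh x - Real.sinh x) (Set.Ici 0) := by
    refine strictMonoOn_of_deriv_pos (convex_Ici 0) (by fun_prop) fun x hx => ?_
    rw [interior_Ici] at hx
    have h := ((hasDerivAt_id' x).mul (Real.hasDerivAt_cosh x)).sub (Real.hasDerivAt_sinh x)
    refine lt_of_lt_of_eq (mul_pos hx (Real.sinh_pos_iff.2 hx)) (h.deriv.trans ?_).symm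
    ring
  have := hmono (Set.self_mem_Ici) hx.le hx
  simp only [zero_mul, Real.sinh_zero, sub_self] at this
  linarith

theorem strictMonoOn_sinh_div : StrictMonoOn (fun x => Real.sinh x / x) (Set.Ioi 0) := by
  refine strictMonoOn_of_deriv_pos (convex_Ioi 0)
    (Real.continuous_sinh.continuousOn.div continuousOn_id fun x hx => (ne_of_gt hx)) fun x hx => ?_
  rw [interior_Ioi] at hx
  have hx0 : 0 < x := hx
  have h := (Real.hasDerivAt_sinh x).div (hasDerivAt_id' x) hx0.ne'
  refine lt_of_lt_of_eq ?_ h.deriv.symm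
  have := sinh_lt_mul_cosh hx0
  apply div_pos _ (by positivity)
  linarith

theorem hasDerivAt_mul_coth {x : ℝ} (hx : 0 < x) :
    HasDerivAt (fun x => x * coth x) (coth x - x * (Real.sinh x ^ 2)⁻¹) x := by
  refine ((hasDerivAt_id' x).mul (hasDerivAt_coth hx)).congr_deriv ?_
  ring

theorem strictMonoOn_mul_coth : StrictMonoOn (fun x => x * coth x) (Set.Ioi 0) := by
  refine strictMonoOn_of_deriv_pos (convex_Ioi 0)
    (continuousOn_id.mul continuousOn_coth) fun x hx => ?_
  rw [interior_Ioi] at hx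
  have hx0 : 0 < x := hx
  rw [(hasDerivAt_mul_coth hx).deriv]
  have hs := Real.self_lt_sinh_iff.2 hx0
  have hc := Real.sinh_lt_cosh x
  have h1 := Real.one_le_cosh x
  have : coth x - x * (Real.sinh x ^ 2)⁻¹
      = (Real.sinh x * Real.cosh x - x) / Real.sinh x ^ 2 := by
    have := (hx0.trans hs).ne'
    unfold coth
    field_simp
  rw [this]
  apply div_pos _ (by positivity)
  nlinarith

theorem one_lt_mul_coth {x : ℝ} (hx : 0 < x) : 1 < x * coth x := by
  have hs := Real.sinh_pos_iff.2 hx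
  rw [coth, mul_div_assoc', one_lt_div hs]
  exact sinh_lt_mul_cosh hx

theorem strictMonoOn_coth_sub_inv : StrictMonoOn (fun x => coth x - x⁻¹) (Set.Ioi 0) := by
  refine strictMonoOn_of_deriv_pos (convex_Ioi 0)
    (continuousOn_coth.sub (continuousOn_id.inv₀ fun x hx => ne_of_gt hx)) fun x hx => ?_
  rw [interior_Ioi] at hx
  have hx0 : 0 < x := hx
  have h := (hasDerivAt_coth hx).sub (hasDerivAt_inv hx0.ne')
  refine lt_of_lt_of_eq ?_ h.deriv.symm
  have hs := Real.self_lt_sinh_iff.2 hx0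
  have : (Real.sinh x ^ 2)⁻¹ < (x ^ 2)⁻¹ := by gcongr
  linarith

/-- The second-order Taylor bound, used to control `threshold 1 y` from above. -/
theorem mul_coth_le {x : ℝ} (hx : 0 < x) : x * coth x ≤ 1 + x ^ 2 / 3 := by
  have hmono : MonotoneOn (fun x => (1 + x ^ 2 / 3) * Real.sinh x - x * Real.cosh x)
      (Set.Ici 0) := by
    refine monotoneOn_of_deriv_nonneg (convex_Ici 0) (by fun_prop) (by fun_prop) fun x hx => ?_
    rw [interior_Ici] at hx
    have hx0 : 0 < x := hx
    have h := ((((hasDerivAt_pow 2 x).div_const 3).const_add 1).mul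
      (Real.hasDerivAt_sinh x)).sub ((hasDerivAt_id' x).mul (Real.hasDerivAt_cosh x))
    have h2 := sinh_lt_mul_cosh hx0
    refine le_of_le_of_eq (b := x / 3 * (x * Real.cosh x - Real.sinh x))
      (mul_nonneg (by positivity) (by linarith)) (h.deriv.trans ?_).symm
    simp
    ring
  have := hmono (Set.self_mem_Ici) hx.le hx.le
  simp only [zero_mul, Real.sinh_zero, mul_zero, sub_self] at this
  have hs := Real.sinh_pos_iff.2 hx
  rw [coth, mul_div_assoc', div_le_iff₀ hs]
  linarith

theorem exp_le_of_le {x : ℝ} (hx : x ≤ 24 / 5) : Real.exp x ≤ 122 := by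
  refine (Real.exp_le_exp.2 hx).trans ?_
  refine le_of_pow_le_pow_left₀ (n := 5) (by norm_num) (by norm_num) ?_
  -- The fifth power turns the claim into a bound on `e ^ 24`, checked from decimals of `e`.
  rw [← Real.exp_nat_mul, show ((5 : ℕ) : ℝ) * (24 / 5) = (24 : ℕ) * 1 by norm_num,
    Real.exp_nat_mul]
  calc Real.exp 1 ^ 24 ≤ 2.7182818286 ^ 24 := by
        have := Real.exp_one_lt_d9.le
        gcongr
    _ ≤ 122 ^ 5 := by norm_num

/-- A slope bound for `x coth x` near `2 s₀`; the interval contains `2 r` for every `r` between `1`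
and `s₀`. -/
theorem antitoneOn_mul_coth_sub :
    AntitoneOn (fun x => x * coth x - 19 / 20 * x) (Set.Icc 2 (12 / 5)) := by
  have hpos : ∀ x ∈ Set.Icc (2 : ℝ) (12 / 5), 0 < x := fun x hx => by linarith [hx.1]
  have hd (x : ℝ) (hx : 0 < x) := (hasDerivAt_mul_coth hx).sub
    ((hasDerivAt_id' x).const_mul (19 / 20 : ℝ))
  refine antitoneOn_of_deriv_nonpos (convex_Icc _ _)
    (fun x hx => (hd x (hpos x hx)).continuousAt.continuousWithinAt)
    (fun x hx => (hd x (hpos x (interior_subset hx))).differentiableAt.differentiableWithinAt)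
    fun x hx => ?_
  have hx' := interior_subset hx
  have hx0 := hpos x hx'
  have hs := Real.sinh_pos_iff.2 hx0
  refine le_of_eq_of_le (hd x hx0).deriv ?_
  have : coth x - x * (Real.sinh x ^ 2)⁻¹ - 19 / 20 * 1
      = (Real.sinh x * Real.cosh x - 19 / 20 * Real.sinh x ^ 2 - x) / Real.sinh x ^ 2 := by
    unfold coth
    field_simp
    ring
  rw [this]
  refine div_nonpos_of_nonpos_of_nonneg ?_ (by positivity)
  set a := Real.exp x with ha
  have ha0 : 0 < a := Real.exp_pos x
  -- Up to a negative multiple of `exp (-x) ^ 2`, the numerator is `a² / 80 + 19 / 40 - x`. The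
  -- value `122` makes this at most `2 - x`, hence nonpositive for `x ≥ 2`.
  have hE : a ^ 2 ≤ 122 := by
    rw [ha, ← Real.exp_nat_mul]
    apply exp_le_of_le
    push_cast
    linarith [hx'.2]
  have hb : Real.exp (-x) * a = 1 := by rw [ha, ← Real.exp_add]; simp
  rw [Real.sinh_eq, Real.cosh_eq, ← ha]
  have hsq := sq_nonneg (Real.exp (-x))
  nlinarith [hx'.1]

theorem exists_eq_coth : ∃ s₀ : ℝ, 1 < s₀ ∧ s₀ < 6 / 5 ∧ s₀ = coth s₀ := by
  have h1 : (1 : ℝ) - coth 1 < 0 := by linarith [one_lt_coth one_pos]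
  have h2 : (0 : ℝ) < 6 / 5 - coth (6 / 5) := by
    have hs : 0 < Real.sinh (6 / 5) := Real.sinh_pos_iff.2 (by norm_num)
    rw [coth, sub_pos, div_lt_iff₀ hs]
    set a := Real.exp (6 / 5) with ha
    have ha0 : 0 < a := Real.exp_pos _
    -- The inequality `cosh < (6 / 5) sinh` at `6 / 5` is equivalent to this one.
    have hE : 11 < a ^ 2 := by
      rw [ha, ← Real.exp_nat_mul]
      refine lt_of_pow_lt_pow_left₀ 5 (Real.exp_pos _).le ?_
      rw [← Real.exp_nat_mul,
        show ((5 : ℕ) : ℝ) * ((2 : ℕ) * (6 / 5)) = (12 : ℕ) * 1 by norm_num, Real.exp_nat_mul]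
      calc (11 : ℝ) ^ 5 < 2.7182818283 ^ 12 := by norm_num
        _ ≤ Real.exp 1 ^ 12 := by
          have := Real.exp_one_gt_d9.le
          gcongr
    rw [Real.sinh_eq, Real.cosh_eq, ← ha]
    have hb : Real.exp (-(6 / 5)) * a = 1 := by rw [ha, ← Real.exp_add]; simp
    nlinarith
  have hc : ContinuousOn (fun s => s - coth s) (Set.Icc 1 (6 / 5)) :=
    continuousOn_id.sub (continuousOn_coth.mono fun x hx => lt_of_lt_of_le one_pos hx.1)
  obtain ⟨s, hs, hs0⟩ := intermediate_value_Ioo (by norm_num) hc ⟨h1, h2⟩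
  exact ⟨s, hs.1, hs.2, sub_eq_zero.1 hs0⟩

theorem le_of_le_coth {s s₀ : ℝ} (hs : 0 < s) (hs₀ : 0 < s₀) (h : s ≤ coth s)
    (h₀ : s₀ = coth s₀) : s ≤ s₀ := by
  by_contra! hlt
  have := strictAntiOn_coth hs₀ hs hlt
  linarith

/-! ### Threshold functions for the roots -/

/-- A mode of frequency `ν = μ y` on a cylinder of length `T = 2 τ / μ` has `μ` between its two
roots if and only if the balance `q` is less than this number. -/
noncomputable def threshold (τ y : ℝ) : ℝ := 2 * y * coth (2 * y * τ) - y ^ 2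

/-- For `q = 1` the characteristic polynomial factors through half angles; the two factors vanish
when `μ` is the low root, respectively the high root. -/
theorem threshold_sub_one {τ y : ℝ} (hτ : 0 < τ) (hy : 0 < y) :
    threshold τ y - 1 = (coth (y * τ) - y) * (y * coth (y * τ) - 1) / coth (y * τ) := by
  have hc := (coth_pos (mul_pos hy hτ)).ne'
  have := two_mul_coth_two_mul (mul_pos hy hτ)
  rw [← mul_assoc] at this
  unfold threshold
  rw [mul_right_comm, this]
  field_simp
  ring

theorem threshold_eq_one_of_eq {τ r : ℝ} (hτ : 0 < τ) (hr : 0 < r) (h : r = coth (r * τ)) :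
    threshold τ r = 1 := by
  have := threshold_sub_one hτ hr
  rw [← h, sub_self, zero_mul, zero_div] at this
  linarith

theorem threshold_eq_one_of_mul_eq {τ y : ℝ} (hτ : 0 < τ) (hy : 0 < y)
    (h : y * coth (y * τ) = 1) : threshold τ y = 1 := by
  have := threshold_sub_one hτ hy
  rw [h, sub_self, mul_zero, zero_div] at this
  linarith

/-- Decreasing `r₀ τ₀` to `r τ` raises `coth`, so `r < coth (r τ)`, and both factors of `threshold τ
r - 1` become positive. -/
theorem one_lt_threshold {τ r τ₀ r₀ : ℝ} (hτ : 0 < τ) (hr : 1 < r) (hττ₀ : τ ≤ τ₀)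
    (hrr₀ : r ≤ r₀) (hne : τ < τ₀ ∨ r < r₀) (h₀ : r₀ = coth (r₀ * τ₀)) :
    1 < threshold τ r := by
  have hr0 : 0 < r := by linarith
  have hpos := mul_pos hr0 hτ
  have hlt : r * τ < r₀ * τ₀ := by
    rcases hne with h | h
    · exact mul_lt_mul' hrr₀ h hτ.le (by linarith)
    · exact mul_lt_mul h hττ₀ hτ (by linarith)
  have h1 : r < coth (r * τ) := by
    have := strictAntiOn_coth hpos (hpos.trans hlt) hlt
    linarith
  have h2 := threshold_sub_one hτ hr0
  have h3 : 0 < (coth (r * τ) - r) * (r * coth (r * τ) - 1) / coth (r * τ) := by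
    apply div_pos (mul_pos (by linarith) _) (by linarith)
    nlinarith
  linarith

theorem hasDerivAt_threshold {τ y : ℝ} (hτ : 0 < τ) (hy : 0 < y) :
    HasDerivAt (fun τ => threshold τ y) (-(2 * y / Real.sinh (2 * y * τ)) ^ 2) τ := by
  have h1 : HasDerivAt (fun τ => 2 * y * τ) (2 * y) τ := by
    simpa using (hasDerivAt_id' τ).const_mul (2 * y)
  have h2 := (((hasDerivAt_coth (by positivity : 0 < 2 * y * τ)).comp τ h1).const_mul
    (2 * y)).sub_const (y ^ 2)
  refine h2.congr_deriv ?_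
  field_simp

/-- Each threshold decreases in `τ` at rate `(2 y / sinh (2 y τ)) ^ 2`, and this rate is smaller for
larger `y` because `sinh u / u` increases. -/
theorem strictMonoOn_threshold_sub {y r : ℝ} (hy : 0 < y) (hyr : y < r) :
    StrictMonoOn (fun τ => threshold τ r - threshold τ y) (Set.Ioi 0) := by
  have hr := hy.trans hyr
  have hd (τ : ℝ) (hτ : 0 < τ) := (hasDerivAt_threshold hτ hr).sub (hasDerivAt_threshold hτ hy)
  refine strictMonoOn_of_deriv_pos (convex_Ioi 0)
    (fun τ hτ => (hd τ hτ).continuousAt.continuousWithinAt) fun τ hτ => ?_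
  rw [interior_Ioi] at hτ
  have hτ0 : 0 < τ := hτ
  refine lt_of_lt_of_eq ?_ (hd τ hτ0).deriv.symm
  have hu : 0 < 2 * y * τ := by positivity
  have hv : 0 < 2 * r * τ := by positivity
  have huv : 2 * y * τ < 2 * r * τ := by gcongr
  have h := strictMonoOn_sinh_div hu hv huv
  have hsu := Real.sinh_pos_iff.2 hu
  have hsv := Real.sinh_pos_iff.2 hv
  have h2 : 2 * r / Real.sinh (2 * r * τ) < 2 * y / Real.sinh (2 * y * τ) := by
    simp only at h
    rw [div_lt_div_iff₀ hu hv] at h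
    rw [div_lt_div_iff₀ hsv hsu]
    refine lt_of_mul_lt_mul_right (a := τ) ?_ hτ0.le
    linarith
  have h3 : 0 < 2 * r / Real.sinh (2 * r * τ) := by positivity
  have := pow_lt_pow_left₀ h2 h3.le two_ne_zero
  linarith

/-- The comparison with frequency zero, whose threshold is the limit `1 / τ`. It reduces to
monotonicity of `coth x - 1 / x` between `2 s₀` and `2 s₀ τ`, with equality at `τ = 1`. -/
theorem inv_lt_threshold {τ s₀ : ℝ} (hτ : 1 < τ) (hs : 0 < s₀) (h₀ : s₀ = coth s₀) :
    τ⁻¹ < threshold τ s₀ := by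
  have hpos : 0 < 2 * s₀ := by positivity
  have hlt : 2 * s₀ < 2 * s₀ * τ := by nlinarith
  have h := strictMonoOn_coth_sub_inv hpos (hpos.trans hlt) hlt
  have h2 := two_mul_coth_two_mul hs
  rw [← h₀] at h2
  have h3 : coth (2 * s₀) - (2 * s₀)⁻¹ = s₀ / 2 := by
    have : coth (2 * s₀) = (s₀ + s₀⁻¹) / 2 := by linarith
    rw [this]
    field_simp
    ring
  simp only [h3] at h
  unfold threshold
  have h4 : τ⁻¹ = 2 * s₀ * (2 * s₀ * τ)⁻¹ := by field_simp
  rw [h4]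
  nlinarith

/-- Monotonicity in `τ` reduces this to `τ = 1`, where the slope bound for `x coth x` and the Taylor
bound compare. The slack `y ≤ 2 z` serves both parities: `y = z` for odd indices, `y = x / μ` and `z
= (x - 1) / μ` with `x ≥ 2` for even ones. -/
theorem threshold_lt_threshold {τ s₀ r y z : ℝ} (hτ : 1 ≤ τ) (hs : s₀ < 6 / 5)
    (h₀ : s₀ = coth s₀) (hr : 1 < r) (hrz : r ≤ s₀ - z) (hy : 0 < y) (hyz : y ≤ 2 * z) :
    threshold τ y < threshold τ r := by
  have hyr : y < r := by linarith
  have hs0 : 0 < s₀ := by linarith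
  have hz : z < s₀ - 1 := by linarith
  have key : threshold 1 y < threshold 1 r := by
    have h1 : threshold 1 y ≤ 1 + y ^ 2 / 3 := by
      have := mul_coth_le (by positivity : 0 < 2 * y)
      unfold threshold
      rw [mul_one]
      linarith
    have h2 := antitoneOn_mul_coth_sub (a := 2 * r) (b := 2 * s₀)
      ⟨by linarith, by linarith⟩ ⟨by linarith, by linarith⟩ (by linarith)
    have h3 := threshold_eq_one_of_eq one_pos hs0 (by rwa [mul_one])
    unfold threshold at h1 h3 ⊢
    rw [mul_one] at h1 h3 ⊢
    rw [mul_one]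
    simp only at h2
    -- Uses `2 s₀ coth (2 s₀) = 1 + s₀²`, which is `threshold 1 s₀ = 1`.
    have h4 : 1 + (s₀ - r) * (s₀ + r - 19 / 10) ≤ 2 * r * coth (2 * r) - r ^ 2 := by linarith
    have h5 : z * (2 * s₀ - z - 19 / 10) ≤ (s₀ - r) * (s₀ + r - 19 / 10) := by nlinarith
    -- With `y ≤ 2 z` and `z < s₀ - 1` it is enough that `s₀ < 13 / 10`.
    have h6 : y ^ 2 / 3 < z * (2 * s₀ - z - 19 / 10) := by nlinarith
    linarith
  have := (strictMonoOn_threshold_sub hy hyr).monotoneOn (a := 1) (b := τ) (Set.mem_Ioi.2 one_pos)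
    (show (0 : ℝ) < τ by linarith) hτ
  linarith

/-! ### Comparing the roots with a given number -/

section Roots

variable {q T μ ν : ℝ}

theorem charPoly_eq_threshold (hT : 0 < T) (hμ : 0 < μ) (hν : 0 < ν) :
    charPoly q T ν μ = (q - threshold (μ * T / 2) (ν / μ)) * (sinhDiv ν T * μ ^ 2) := by
  have hS := (sinhDiv_pos ν hT).ne'
  have h1 : 2 * (ν / μ) * (μ * T / 2) = ν * T := by field_simp
  have h2 := mul_sinhDiv ν T
  unfold threshold coth charPoly
  rw [h1, ← h2]
  field_simp
  ring

/-- A number not exceeding the smaller root lies where the upward parabola is nonnegative. -/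
theorem threshold_le_of_le_lowRoot (hq : 0 < q) (hq1 : q ≤ 1) (hT : 0 < T) (hμ : 0 < μ)
    (hν : 0 < ν) (h : μ ≤ lowRoot q T ν) : threshold (μ * T / 2) (ν / μ) ≤ q := by
  have hS := sinhDiv_pos ν hT
  have h1 := charPoly_eq hq hq1 hT ν μ
  have h2 := lowRoot_lt_highRoot hq hq1 hT ν
  have h3 : 0 ≤ charPoly q T ν μ := by
    rw [h1]
    exact mul_nonneg (by positivity)
      (mul_nonneg_of_nonpos_of_nonpos (by linarith) (by linarith))
  rw [charPoly_eq_threshold hT hμ hν] at h3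
  have := nonneg_of_mul_nonneg_left h3 (by positivity)
  linarith

/-- From `cosh > sinh` and `rootDisc > √(1 - q) sinh` one gets `lowRoot < ν / (1 + √(1 - q))`. This
forces `ν / μ > 1` and keeps `q` close to `1` when `ν / μ` is. -/
theorem sqrt_lt_of_le_lowRoot (hq1 : q ≤ 1) (hT : 0 < T) (hμ : 0 < μ)
    (hν : 0 < ν) (h : μ ≤ lowRoot q T ν) : √(1 - q) < ν / μ - 1 := by
  have hS := sinhDiv_pos ν hT
  have hD := rootDisc_pos hq1 T ν
  have hD2 := sq_rootDisc hq1 T ν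
  rw [disc_eq] at hD2
  have hC := Real.cosh_pos (ν * T)
  have hCS : ν * sinhDiv ν T < Real.cosh (ν * T) := by
    rw [mul_sinhDiv]
    exact Real.sinh_lt_cosh _
  have hDS : √(1 - q) * (ν * sinhDiv ν T) < rootDisc q T ν := by
    refine lt_of_pow_lt_pow_left₀ 2 hD.le ?_
    rw [hD2, mul_pow, Real.sq_sqrt (by linarith)]
    linarith
  rw [lowRoot, le_div_iff₀ (by positivity)] at h
  have h1 : μ * (1 + √(1 - q)) * (ν * sinhDiv ν T) < ν * (ν * sinhDiv ν T) := by nlinarith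
  have h2 := lt_of_mul_lt_mul_right h1 (by positivity)
  rw [lt_sub_iff_add_lt, lt_div_iff₀ hμ]
  linarith

/-- The product of the roots is `ν² / q ≤ μ²`, so the smaller root cannot exceed `μ`; hence `μ` lies
between the roots, where the parabola is nonpositive. -/
theorem le_threshold_of_le_highRoot (hq : 0 < q) (hq1 : q ≤ 1) (hT : 0 < T) (hμ : 0 < μ)
    (hν : 0 < ν) (hνq : (ν / μ) ^ 2 ≤ q) (h : μ ≤ highRoot q T ν) :
    q ≤ threshold (μ * T / 2) (ν / μ) := by
  have hS := sinhDiv_pos ν hT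
  have hD := rootDisc_pos hq1 T ν
  have hC := Real.cosh_pos (ν * T)
  have h1 := charPoly_eq hq hq1 hT ν μ
  have h2 := lowRoot_lt_highRoot hq hq1 hT ν
  have hprod : lowRoot q T ν * highRoot q T ν = ν ^ 2 / q := by
    unfold lowRoot highRoot
    field_simp
  have hlow : lowRoot q T ν ≤ μ := by
    by_contra! hlt
    have : μ * μ < ν ^ 2 / q := by
      rw [← hprod]
      exact mul_lt_mul'' hlt (hlt.trans h2) hμ.le hμ.le
    rw [lt_div_iff₀ hq] at this
    rw [div_pow, div_le_iff₀ (by positivity)] at hνq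
    nlinarith
  have h3 : charPoly q T ν μ ≤ 0 := by
    rw [h1]
    exact mul_nonpos_of_nonneg_of_nonpos (by positivity)
      (mul_nonpos_of_nonneg_of_nonpos (by linarith) (by linarith))
  rw [charPoly_eq_threshold hT hμ hν] at h3
  have := nonpos_of_mul_nonpos_left h3 (by positivity)
  linarith

theorem highRoot_zero (q T : ℝ) : highRoot q T 0 = 2 / (q * T) := by
  simp [highRoot, rootDisc, sinhDiv]
  norm_num

theorem lowRoot_zero (q T : ℝ) : lowRoot q T 0 = 0 := by
  simp [lowRoot]

end Roots

/-! ### Monotonicity of the low root, the balanced case, and the two main comparisons. -/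

section Roots

variable {q T : ℝ}

theorem lowRoot_eq_div_coth (hT : 0 < T) {ν : ℝ} (hν : 0 < ν) :
    lowRoot q T ν = ν / (coth (ν * T) + √(coth (ν * T) ^ 2 - q)) := by
  have hS := sinhDiv_pos ν hT
  have hC := Real.cosh_pos (ν * T)
  have hνS : 0 < ν * sinhDiv ν T := mul_pos hν hS
  have h1 : rootDisc q T ν = ν * sinhDiv ν T * √(coth (ν * T) ^ 2 - q) := by
    have h2 : Real.cosh (ν * T) ^ 2 - q * (ν ^ 2 * sinhDiv ν T ^ 2)
        = (ν * sinhDiv ν T) ^ 2 * (coth (ν * T) ^ 2 - q) := by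
      rw [coth, ← mul_sinhDiv]
      field_simp
    rw [rootDisc, h2, Real.sqrt_mul (sq_nonneg _), Real.sqrt_sq hνS.le]
  have h2 : Real.cosh (ν * T) = ν * sinhDiv ν T * coth (ν * T) := by
    rw [coth, ← mul_sinhDiv]
    field_simp
  have h3 : 0 < coth (ν * T) + √(coth (ν * T) ^ 2 - q) :=
    add_pos_of_pos_of_nonneg (coth_pos (mul_pos hν hT)) (Real.sqrt_nonneg _)
  rw [lowRoot, h1, h2]
  field_simp

theorem lowRoot_le_lowRoot (hT : 0 < T) {a b : ℝ} (ha : 0 ≤ a) (hab : a ≤ b) :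
    lowRoot q T a ≤ lowRoot q T b := by
  rcases ha.eq_or_lt with rfl | ha
  · rw [lowRoot_zero]
    exact lowRoot_nonneg hT _ _
  have hb := ha.trans_le hab
  have hab' : a * T ≤ b * T := by gcongr
  have hc : coth (b * T) ≤ coth (a * T) :=
    strictAntiOn_coth.antitoneOn (mul_pos ha hT) (mul_pos hb hT) hab'
  have hpos := coth_pos (mul_pos hb hT)
  rw [lowRoot_eq_div_coth hT ha, lowRoot_eq_div_coth hT hb]
  have := Real.sqrt_nonneg (coth (b * T) ^ 2 - q)
  gcongr

theorem lowRoot_abs (q T ν : ℝ) : lowRoot q T |ν| = lowRoot q T ν := by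
  rcases abs_choice ν with h | h <;> simp [h, lowRoot, rootDisc, sinhDiv_neg_left]

theorem highRoot_abs (q T ν : ℝ) : highRoot q T |ν| = highRoot q T ν := by
  rcases abs_choice ν with h | h <;> simp [h, highRoot, rootDisc, sinhDiv_neg_left]

theorem rootDisc_one (T ν : ℝ) : rootDisc 1 T ν = 1 := by
  rw [rootDisc, disc_eq]
  simp

theorem lowRoot_one (T ν : ℝ) : lowRoot 1 T ν = ν * Real.tanh (ν * T / 2) := by
  have hc := (Real.cosh_pos (ν * T / 2)).ne'
  have h1 : ν ^ 2 * sinhDiv ν T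
      = ν * (2 * Real.sinh (ν * T / 2) * Real.cosh (ν * T / 2)) := by
    rw [← Real.sinh_two_mul, sq, mul_assoc, mul_sinhDiv, mul_div_cancel₀ _ (two_ne_zero' ℝ)]
  have h2 : Real.cosh (ν * T) + 1 = 2 * Real.cosh (ν * T / 2) ^ 2 := by
    have h3 := Real.cosh_two_mul (ν * T / 2)
    rw [mul_div_cancel₀ _ (two_ne_zero' ℝ)] at h3
    linarith [Real.cosh_sq (ν * T / 2)]
  rw [lowRoot, rootDisc_one, h1, h2, Real.tanh_eq_sinh_div_cosh]
  field_simp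

theorem highRoot_one (hT : 0 < T) {ν : ℝ} (hν : 0 < ν) :
    highRoot 1 T ν = ν * coth (ν * T / 2) := by
  have hs := (Real.sinh_pos_iff.2 (by positivity : 0 < ν * T / 2)).ne'
  have hc := (Real.cosh_pos (ν * T / 2)).ne'
  have h1 : sinhDiv ν T
      = 2 * Real.sinh (ν * T / 2) * Real.cosh (ν * T / 2) / ν := by
    rw [← Real.sinh_two_mul, mul_div_cancel₀ _ (two_ne_zero' ℝ), ← mul_sinhDiv,
      mul_div_cancel_left₀ _ hν.ne']
  have h2 : Real.cosh (ν * T) + 1 = 2 * Real.cosh (ν * T / 2) ^ 2 := by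
    have h3 := Real.cosh_two_mul (ν * T / 2)
    rw [mul_div_cancel₀ _ (two_ne_zero' ℝ)] at h3
    linarith [Real.cosh_sq (ν * T / 2)]
  rw [highRoot, rootDisc_one, h1, h2, coth]
  field_simp

/-- The comparison behind the maximization of the odd-indexed eigenvalues. -/
theorem lowRoot_lt_of_le_highRoot_of_eq_coth (hq : 0 < q) (hq1 : q ≤ 1) (hT : 0 < T) {s₀ : ℝ}
    (hs1 : 1 < s₀) (hs2 : s₀ < 6 / 5) (h₀ : s₀ = coth s₀) {k x : ℕ} (hk : 1 ≤ k) (hx : x ≤ k)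
    (h : k / s₀ ≤ highRoot q T x) (hne : ¬(q = 1 ∧ T = 2 * s₀ / k)) :
    lowRoot q T ((k - x : ℕ) : ℝ) < k / s₀ := by
  have hk0 : (0 : ℝ) < k := by exact_mod_cast hk
  have hs0 : 0 < s₀ := by linarith
  set μ : ℝ := k / s₀ with hμ
  have hμ0 : 0 < μ := by positivity
  by_contra! hle
  rcases Nat.eq_zero_or_pos (k - x) with hn | hn
  · rw [hn, Nat.cast_zero, lowRoot_zero] at hle
    linarith
  have hν : (0 : ℝ) < (k - x : ℕ) := by exact_mod_cast hn
  have h1 := threshold_le_of_le_lowRoot hq hq1 hT hμ0 hν hle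
  have h2 := sqrt_lt_of_le_lowRoot hq1 hT hμ0 hν hle
  have hr : ((k - x : ℕ) : ℝ) / μ = s₀ - x / μ := by
    rw [Nat.cast_sub hx, hμ]
    field_simp
  rw [hr] at h1 h2
  have hsq0 := Real.sqrt_nonneg (1 - q)
  have hτ : 0 < μ * T / 2 := by positivity
  -- At frequency zero the high root is `2 / (q T)`, so the hypothesis reads `q ≤ 1 / τ` with `τ = μ
  -- T / 2`; the extremal length is `τ = 1`.
  rcases Nat.eq_zero_or_pos x with rfl | hx0
  · rw [Nat.cast_zero, highRoot_zero, le_div_iff₀ (by positivity)] at h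
    rw [Nat.cast_zero, zero_div, sub_zero] at h1
    rcases lt_trichotomy (μ * T / 2) 1 with hlt | heq | hgt
    · have := one_lt_threshold hτ hs1 hlt.le le_rfl (Or.inl hlt) (by rwa [mul_one])
      linarith
    · rw [heq, threshold_eq_one_of_eq one_pos hs0 (by rwa [mul_one])] at h1
      refine hne ⟨le_antisymm hq1 h1, ?_⟩
      rw [hμ] at heq
      field_simp at heq ⊢
      linarith
    · have h3 := inv_lt_threshold hgt hs0 h₀
      have h4 : q ≤ (μ * T / 2)⁻¹ := by
        rw [← one_div, le_div_iff₀ hτ]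
        linarith
      linarith
  · have hy : (0 : ℝ) < x / μ := by positivity
    -- `h2` gives `x / μ + √(1 - q) < s₀ - 1 < 1 / 5`.
    have hqy : (x / μ) ^ 2 ≤ q := by
      have := Real.sq_sqrt (show 0 ≤ 1 - q by linarith)
      nlinarith
    have h3 := le_threshold_of_le_highRoot hq hq1 hT hμ0 (by positivity) hqy h
    rcases lt_or_ge (μ * T / 2) 1 with hlt | hge
    · have := one_lt_threshold hτ (r := s₀ - x / μ) (by linarith) hlt.le
        (show s₀ - x / μ ≤ s₀ by linarith) (Or.inl hlt) (by rwa [mul_one])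
      linarith
    · have := threshold_lt_threshold hge hs2 h₀ (r := s₀ - x / μ) (by linarith) le_rfl hy
        (by linarith)
      linarith

/-- The comparison behind the maximization of the even-indexed eigenvalues. -/
theorem lowRoot_lt_of_le_highRoot_of_mul_tanh_eq (hq : 0 < q) (hq1 : q ≤ 1) (hT : 0 < T)
    {t : ℝ} (ht : 0 < t) {k x : ℕ} (hk : 2 ≤ k)
    (hroot : k * Real.tanh (k * t / 2) = coth (t / 2)) (hx1 : 1 ≤ x) (hx : x ≤ k)
    (h : coth (t / 2) ≤ highRoot q T x) (hne : ¬(q = 1 ∧ T = t)) :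
    lowRoot q T ((k + 1 - x : ℕ) : ℝ) < coth (t / 2) := by
  obtain ⟨s₀, hs1, hs2, h₀⟩ := exists_eq_coth
  have hk0 : (2 : ℝ) ≤ k := by exact_mod_cast hk
  have hx0 : (1 : ℝ) ≤ x := by exact_mod_cast hx1
  set μ := coth (t / 2) with hμ
  have hμ0 : 0 < μ := coth_pos (by positivity)
  by_contra! hle
  have hn : 0 < k + 1 - x := by omega
  have hν : (0 : ℝ) < (k + 1 - x : ℕ) := by exact_mod_cast hn
  have h1 := threshold_le_of_le_lowRoot hq hq1 hT hμ0 hν hle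
  have h2 := sqrt_lt_of_le_lowRoot hq1 hT hμ0 hν hle
  have hr : ((k + 1 - x : ℕ) : ℝ) / μ = k / μ - (x / μ - 1 / μ) := by
    rw [Nat.cast_sub (by omega)]
    push_cast
    ring
  rw [hr] at h1 h2
  have hsq0 := Real.sqrt_nonneg (1 - q)
  set τ := μ * T / 2 with hτdef
  have hτ : 0 < τ := by positivity
  set τ₁ := μ * t / 2 with hτ₁def
  have hτ₁ : 1 < τ₁ := by
    have := one_lt_mul_coth (by positivity : 0 < t / 2)
    rw [← hμ] at this
    linarith
  have hτ₁0 : 0 < τ₁ := by linarith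
  have hr₁ : k / μ = coth (k / μ * τ₁) := by
    have : k / μ * τ₁ = k * t / 2 := by
      rw [hτ₁def]
      field_simp
    have hth : Real.tanh (k * t / 2) ≠ 0 := fun h0 => by
      rw [h0, mul_zero] at hroot
      exact hμ0.ne hroot
    rw [this, coth_eq_inv_tanh, ← hroot]
    field_simp
  have hr₁0 : 0 < k / μ := by positivity
  -- Since `τ₁ > 1`, the fixed-point equation gives `k / μ ≤ coth (k / μ)`, so the numerical bound
  -- on `s₀` is available here too.
  have hr₁s : k / μ ≤ s₀ := by
    refine le_of_le_coth hr₁0 (by linarith) ?_ h₀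
    nth_rewrite 1 [hr₁]
    refine strictAntiOn_coth.antitoneOn hr₁0 (mul_pos hr₁0 hτ₁0) ?_
    nlinarith
  have hy₁ : 0 < 1 / μ := by positivity
  have hy₁r : 2 * (1 / μ) ≤ k / μ := by
    rw [← mul_div_assoc, mul_one]
    gcongr
  have hq2 := Real.sq_sqrt (show 0 ≤ 1 - q by linarith)
  -- For `x = 1` both thresholds equal `1` at `τ₁`, the extremal length, so monotonicity of their
  -- difference decides. For `x ≥ 2` the estimate of the odd case applies.
  rcases hx1.eq_or_lt with rfl | hx2
  · rw [Nat.cast_one, sub_self, sub_zero] at h1 h2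
    rw [Nat.cast_one] at h
    have h3 := le_threshold_of_le_highRoot hq hq1 hT hμ0 one_pos
      (by nlinarith : (1 / μ) ^ 2 ≤ q) h
    have ht1 : threshold τ₁ (k / μ) = 1 := threshold_eq_one_of_eq hτ₁0 hr₁0 hr₁
    have ht2 : threshold τ₁ (1 / μ) = 1 := by
      refine threshold_eq_one_of_mul_eq hτ₁0 hy₁ ?_
      have : 1 / μ * τ₁ = t / 2 := by
        rw [hτ₁def]
        field_simp
      rw [this, ← hμ]
      field_simp
    rcases lt_trichotomy τ τ₁ with hlt | heq | hgt
    · have := one_lt_threshold hτ (r := k / μ) (by linarith) hlt.le le_rfl (Or.inl hlt) hr₁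
      linarith
    · rw [heq, ht1] at h1
      refine hne ⟨le_antisymm hq1 h1, ?_⟩
      rw [hτdef, hτ₁def] at heq
      field_simp at heq
      exact heq
    · have := strictMonoOn_threshold_sub hy₁ (by linarith : 1 / μ < k / μ)
        (Set.mem_Ioi.2 hτ₁0) (Set.mem_Ioi.2 hτ) hgt
      simp only [ht1, ht2] at this
      linarith
  · have hx2' : (2 : ℝ) ≤ x := by exact_mod_cast hx2
    have hxy : 2 * (1 / μ) ≤ x / μ := by
      rw [← mul_div_assoc, mul_one]
      gcongr
    have hy : (0 : ℝ) < x / μ := by positivity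
    have h3 := le_threshold_of_le_highRoot hq hq1 hT hμ0 (by linarith)
      (by nlinarith : (x / μ) ^ 2 ≤ q) h
    rcases lt_or_ge τ 1 with hlt | hge
    · have := one_lt_threshold hτ (r := k / μ - (x / μ - 1 / μ)) (by linarith) hlt.le
        (show k / μ - (x / μ - 1 / μ) ≤ s₀ by linarith) (Or.inl hlt) (by rwa [mul_one])
      linarith
    · have := threshold_lt_threshold hge hs2 h₀ (r := k / μ - (x / μ - 1 / μ))
        (z := x / μ - 1 / μ) (by linarith) (by linarith) hy (by linarith)
      linarith

end Roots

/-! ### The root of the even-index equation, and admissible metrics. -/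

theorem tanh_eq_inv_coth (x : ℝ) : Real.tanh x = (coth x)⁻¹ := by
  rw [coth_eq_inv_tanh, inv_inv]

theorem strictMonoOn_tanh : StrictMonoOn Real.tanh (Set.Ioi 0) := by
  intro x hx y hy hxy
  rw [tanh_eq_inv_coth, tanh_eq_inv_coth]
  exact inv_strictAnti₀ (coth_pos hy) (strictAntiOn_coth hx hy hxy)

/-- The equation `k tanh (k s / 2) = coth (s / 2)` has a unique positive root. -/
theorem existsUnique_mul_tanh_eq_coth {k : ℕ} (hk : 2 ≤ k) :
    ∃ s₁ : ℝ, (0 < s₁ ∧ k * Real.tanh (k * s₁ / 2) = coth (s₁ / 2)) ∧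
      ∀ s : ℝ, 0 < s → k * Real.tanh (k * s / 2) = coth (s / 2) → s = s₁ := by
  have hk2 : (2 : ℝ) ≤ k := by exact_mod_cast hk
  have hk0 : (0 : ℝ) < k := by linarith
  set g : ℝ → ℝ := fun s => k * Real.tanh (k * s / 2) - coth (s / 2) with hg
  have hmono : StrictMonoOn g (Set.Ioi 0) := by
    intro a ha b hb hab
    have ha' : 0 < a := ha
    have hb' : 0 < b := hb
    have h1 : Real.tanh (k * a / 2) < Real.tanh (k * b / 2) :=
      strictMonoOn_tanh (Set.mem_Ioi.2 (by positivity)) (Set.mem_Ioi.2 (by positivity))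
        (by gcongr)
    have h2 : coth (b / 2) < coth (a / 2) :=
      strictAntiOn_coth (Set.mem_Ioi.2 (by positivity)) (Set.mem_Ioi.2 (by positivity))
        (by gcongr)
    have h3 := mul_lt_mul_of_pos_left h1 hk0
    simp only [hg]
    linarith
  -- Here `x coth x > 1` gives `coth (1 / (2 k)) > 2 k`, while the other term is below `k`.
  have hleft : g (1 / k) < 0 := by
    have h1 := one_lt_mul_coth (by positivity : 0 < 1 / (k : ℝ) / 2)
    have h2 := Real.tanh_lt_one (k * (1 / k) / 2)
    have h3 : 2 * k < coth (1 / k / 2) := by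
      have : 1 / (k : ℝ) / 2 * coth (1 / k / 2) = coth (1 / k / 2) / (2 * k) := by field_simp
      rwa [this, one_lt_div (by positivity)] at h1
    simp only [hg]
    nlinarith
  -- At `4` it suffices that `coth 2 ^ 2 < 2 ≤ k`.
  have hright : 0 < g 4 := by
    have hs : (2 : ℝ) < Real.sinh 2 := Real.self_lt_sinh_iff.2 two_pos
    have hc := Real.cosh_sq 2
    have hpos := coth_pos (two_pos : (0 : ℝ) < 2)
    have h1 : coth 2 ^ 2 < 2 := by
      rw [coth, div_pow, div_lt_iff₀ (by positivity)]
      nlinarith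
    have h2 : Real.tanh 2 ≤ Real.tanh (k * 4 / 2) :=
      strictMonoOn_tanh.monotoneOn (Set.mem_Ioi.2 two_pos) (Set.mem_Ioi.2 (by positivity))
        (by linarith)
    rw [tanh_eq_inv_coth] at h2
    have h3 : coth 2 < k * (coth 2)⁻¹ := by
      rw [← div_eq_mul_inv, lt_div_iff₀ hpos]
      linarith
    have h4 := mul_le_mul_of_nonneg_left h2 hk0.le
    simp only [hg]
    rw [show (4 : ℝ) / 2 = 2 by norm_num]
    linarith
  have hle : 1 / (k : ℝ) ≤ 4 := by
    rw [div_le_iff₀ hk0]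
    linarith
  have hcont : ContinuousOn g (Set.Icc (1 / k) 4) := by
    have htanh : Continuous Real.tanh := by
      rw [show Real.tanh = fun x => Real.sinh x / Real.cosh x from
        funext Real.tanh_eq_sinh_div_cosh]
      exact Real.continuous_sinh.div Real.continuous_cosh fun x => (Real.cosh_pos x).ne'
    refine ContinuousOn.sub (by fun_prop) (continuousOn_coth.comp (by fun_prop) fun s hs => ?_)
    have : 0 < 1 / (k : ℝ) := by positivity
    exact Set.mem_Ioi.2 (by linarith [hs.1])
  obtain ⟨s₁, hs₁, h0⟩ := intermediate_value_Ioo hle hcont ⟨hleft, hright⟩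
  have hs₁0 : 0 < s₁ := lt_trans (by positivity) hs₁.1
  refine ⟨s₁, ⟨hs₁0, sub_eq_zero.1 h0⟩, fun s hs h => ?_⟩
  exact hmono.injOn hs hs₁0 ((sub_eq_zero.2 h).trans h0.symm)

theorem isRotMetric_one {T : ℝ} (hT : 0 < T) : IsRotMetric T fun _ => 1 :=
  ⟨hT, contDiffOn_const, fun _ _ => one_pos⟩

theorem IsRotMetric.balance_mem {T : ℝ} {f : ℝ → ℝ} (hf : IsRotMetric T f) :
    0 < balance (f 0) (f T) ∧ balance (f 0) (f T) ≤ 1 :=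
  have hT := hf.pos_length
  have hα := hf.pos 0 ⟨le_rfl, hT.le⟩
  have hβ := hf.pos T ⟨hT.le, le_rfl⟩
  ⟨balance_pos hα hβ, balance_le_one hα hβ⟩

theorem IsRotMetric.balance_eq_one_iff {T : ℝ} {f : ℝ → ℝ} (hf : IsRotMetric T f) :
    balance (f 0) (f T) = 1 ↔ f 0 = f T :=
  have hT := hf.pos_length
  Steklov.balance_eq_one_iff (hf.pos 0 ⟨le_rfl, hT.le⟩) (hf.pos T ⟨hT.le, le_rfl⟩)

/-! ### Bounds for normalized eigenvalues by counting frequencies -/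

section Counting

variable {T : ℝ} {f : ℝ → ℝ} {ρ : ℝ}

theorem abs_cast_le {j : ℕ} {m : ℤ} (hm : m ∈ Finset.Icc (-(j : ℤ)) j) :
    |(m : ℝ)| ≤ j := by
  have : |m| ≤ (j : ℤ) := abs_le.2 (Finset.mem_Icc.1 hm)
  exact_mod_cast this

theorem card_Icc_neg (j : ℕ) : (Finset.Icc (-(j : ℤ)) j).card = 2 * j + 1 := by
  rw [Int.card_Icc]
  omega

theorem card_union_product (I J : Finset ℤ) :
    (I ×ˢ {false} ∪ J ×ˢ {true}).card = I.card + J.card := by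
  rw [Finset.card_union_of_disjoint, Finset.card_product, Finset.card_product]
  · simp
  · rw [Finset.disjoint_left]
    rintro ⟨m, b⟩ h1 h2
    simp only [Finset.mem_product, Finset.mem_singleton] at h1 h2
    exact absurd (h1.2.symm.trans h2.2) (by simp)

theorem normalizedSteklov_lt_of_lowRoot_of_highRoot (hf : IsRotMetric T f) {k n : ℕ}
    {J : Finset ℤ} (hn : lowRoot (balance (f 0) (f T)) T n < ρ)
    (hJ : ∀ m ∈ J, highRoot (balance (f 0) (f T)) T m < ρ) (hk : k ≤ 2 * n + J.card) :
    normalizedSteklov T f k < 4 * Real.pi * ρ := by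
  refine normalizedSteklov_lt hf (P := Finset.Icc (-(n : ℤ)) n ×ˢ {false} ∪ J ×ˢ {true})
    ?_ (by rw [card_union_product, card_Icc_neg]; omega)
  rintro ⟨m, b⟩ hp
  simp only [Finset.mem_union, Finset.mem_product, Finset.mem_singleton] at hp
  rcases hp with ⟨hm, rfl⟩ | ⟨hm, rfl⟩
  · simp only [modeRoot, Bool.false_eq_true, if_false]
    rw [← lowRoot_abs]
    exact (lowRoot_le_lowRoot hf.pos_length (abs_nonneg _) (abs_cast_le hm)).trans_lt hn
  · simpa only [modeRoot, if_true] using hJ m hm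

theorem normalizedSteklov_le_lowRoot (hf : IsRotMetric T f) {k n : ℕ} (hk : k ≤ 2 * n) :
    normalizedSteklov T f k ≤ 4 * Real.pi * lowRoot (balance (f 0) (f T)) T n := by
  refine normalizedSteklov_le hf (P := Finset.Icc (-(n : ℤ)) n ×ˢ {false})
    ?_ (by rw [Finset.card_product, card_Icc_neg]; simp; omega)
  rintro ⟨m, b⟩ hp
  simp only [Finset.mem_product, Finset.mem_singleton] at hp
  obtain ⟨hm, rfl⟩ := hp
  simp only [modeRoot, Bool.false_eq_true, if_false]
  rw [← lowRoot_abs]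
  exact lowRoot_le_lowRoot hf.pos_length (abs_nonneg _) (abs_cast_le hm)

/-- Only the `2 n + 1` low roots with `|m| ≤ n` and the high roots in `J` can lie below the low root
of frequency `n + 1`. -/
theorem lowRoot_le_normalizedSteklov (hf : IsRotMetric T f) {k n : ℕ} {J : Finset ℤ}
    (hJ : ∀ m ∉ J, lowRoot (balance (f 0) (f T)) T (n + 1 : ℕ)
      ≤ highRoot (balance (f 0) (f T)) T m)
    (hk : 2 * n + 1 + J.card ≤ k) :
    4 * Real.pi * lowRoot (balance (f 0) (f T)) T (n + 1 : ℕ) ≤ normalizedSteklov T f k := by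
  refine le_normalizedSteklov hf (P := Finset.Icc (-(n : ℤ)) n ×ˢ {false} ∪ J ×ˢ {true})
    ?_ (by rw [card_union_product, card_Icc_neg]; omega)
  rintro ⟨m, b⟩ hp
  simp only [Finset.mem_union, Finset.mem_product, Finset.mem_singleton]
  by_contra! hnot
  cases b
  · simp only [modeRoot, Bool.false_eq_true, if_false] at hp
    have hm : ((n + 1 : ℕ) : ℝ) ≤ |(m : ℝ)| := by
      have h1 : m ∉ Finset.Icc (-(n : ℤ)) n := fun h => hnot.1 h rfl
      have h2 : ((n + 1 : ℕ) : ℤ) ≤ |m| := by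
        rw [Finset.mem_Icc, ← abs_le, not_le] at h1
        push_cast
        omega
      exact_mod_cast h2
    rw [← lowRoot_abs] at hp
    exact absurd (lowRoot_le_lowRoot hf.pos_length (by positivity) hm) (not_le.2 hp)
  · simp only [modeRoot, if_true] at hp
    exact absurd (hJ m fun h => hnot.2 h rfl) (not_le.2 hp)

end Counting

/-! ### Odd indices -/

section Odd

variable {T : ℝ} {f : ℝ → ℝ} {s₀ : ℝ} {k : ℕ}

theorem normalizedSteklov_odd_lt (hf : IsRotMetric T f) (hs1 : 1 < s₀) (hs2 : s₀ < 6 / 5)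
    (h₀ : s₀ = coth s₀) (hk : 1 ≤ k) (hne : ¬(f 0 = f T ∧ T = 2 * s₀ / k)) :
    normalizedSteklov T f (2 * k - 1) < 4 * Real.pi * (k / s₀) := by
  classical
  obtain ⟨hq, hq1⟩ := hf.balance_mem
  set q := balance (f 0) (f T) with hqdef
  have hne' : ¬(q = 1 ∧ T = 2 * s₀ / k) := fun h => hne ⟨hf.balance_eq_one_iff.1 h.1, h.2⟩
  have hk0 : (0 : ℝ) < k := by exact_mod_cast hk
  -- The alternative `x = k` caps the search, since `lowRoot` at frequency zero is `0`. For `x ≥ 1`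
  -- there are `2 x - 1` high and `2 (k - x) + 1` low roots below `k / s₀`, in all the required `2
  -- k`.
  have hex : ∃ x : ℕ, x = k ∨ k / s₀ ≤ highRoot q T x := ⟨k, Or.inl rfl⟩
  set x := Nat.find hex with hx
  have hxk : x ≤ k := Nat.find_le (Or.inl rfl)
  have hlow : lowRoot q T ((k - x : ℕ) : ℝ) < k / s₀ := by
    rcases Nat.find_spec hex with h | h
    · rw [hx, h, Nat.sub_self, Nat.cast_zero, lowRoot_zero]
      positivity
    · exact lowRoot_lt_of_le_highRoot_of_eq_coth hq hq1 hf.pos_length hs1 hs2 h₀ hk hxk h hne'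
  have hhigh (y : ℕ) (hy : y < x) : highRoot q T y < k / s₀ :=
    not_le.1 fun h => Nat.find_min hex hy (Or.inr h)
  rcases Nat.eq_zero_or_pos x with h0 | hpos
  · exact normalizedSteklov_lt_of_lowRoot_of_highRoot hf (J := ∅) hlow (by simp)
      (by rw [Finset.card_empty]; omega)
  · refine normalizedSteklov_lt_of_lowRoot_of_highRoot hf
      (J := Finset.Icc (-((x - 1 : ℕ) : ℤ)) (x - 1 : ℕ)) hlow (fun m hm => ?_)
      (by rw [card_Icc_neg]; omega)
    rw [← highRoot_abs, ← Int.cast_abs, ← Int.natCast_natAbs, Int.cast_natCast]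
    refine hhigh _ ?_
    rw [Finset.mem_Icc] at hm
    omega

theorem normalizedSteklov_odd_eq (hf : IsRotMetric T f) (hs : 0 < s₀) (h₀ : s₀ = coth s₀)
    (hk : 1 ≤ k) (hfT : f 0 = f T) (hT : T = 2 * s₀ / k) :
    normalizedSteklov T f (2 * k - 1) = 4 * Real.pi * (k / s₀) := by
  have hk0 : (0 : ℝ) < k := by exact_mod_cast hk
  have hq := hf.balance_eq_one_iff.2 hfT
  have hT0 := hf.pos_length
  have hroot : lowRoot (balance (f 0) (f T)) T k = k / s₀ := by
    have : (k : ℝ) * T / 2 = s₀ := by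
      rw [hT]
      field_simp
    rw [hq, lowRoot_one, this, tanh_eq_inv_coth, ← h₀]
    rfl
  refine le_antisymm ?_ ?_
  · rw [← hroot]
    exact normalizedSteklov_le_lowRoot hf (by omega)
  · have := lowRoot_le_normalizedSteklov hf (k := 2 * k - 1) (n := k - 1) (J := ∅)
      (fun m _ => ?_) (by rw [Finset.card_empty]; omega)
    · rwa [Nat.sub_add_cancel hk, hroot] at this
    · rw [Nat.sub_add_cancel hk, hroot, hq, ← highRoot_abs]
      -- The target is the high root of frequency zero; `x coth x > 1` puts the other high roots
      -- above it.
      have h2T : k / s₀ = 2 / T := by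
        rw [hT]
        field_simp
      rw [h2T]
      rcases (abs_nonneg (m : ℝ)).eq_or_lt with h | h
      · rw [← h, highRoot_zero, one_mul]
      · rw [highRoot_one hT0 h, div_le_iff₀ hT0]
        have := one_lt_mul_coth (by positivity : 0 < |(m : ℝ)| * T / 2)
        linarith

end Odd

/-! ### Even indices from four on -/

section Even

variable {T : ℝ} {f : ℝ → ℝ} {t : ℝ} {k : ℕ}

theorem normalizedSteklov_even_lt (hf : IsRotMetric T f) (hk : 2 ≤ k) (ht : 0 < t)
    (hroot : k * Real.tanh (k * t / 2) = coth (t / 2)) (hne : ¬(f 0 = f T ∧ T = t)) :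
    normalizedSteklov T f (2 * k) < 4 * Real.pi * coth (t / 2) := by
  classical
  obtain ⟨hq, hq1⟩ := hf.balance_mem
  set q := balance (f 0) (f T) with hqdef
  have hne' : ¬(q = 1 ∧ T = t) := fun h => hne ⟨hf.balance_eq_one_iff.1 h.1, h.2⟩
  -- Frequency zero is left out: `2 (x - 1)` high roots and `2 (k + 1 - x) + 1` low roots make the
  -- required `2 k + 1`.
  have hex : ∃ x : ℕ, x = k + 1 ∨ 1 ≤ x ∧ coth (t / 2) ≤ highRoot q T x := ⟨k + 1, Or.inl rfl⟩
  set x := Nat.find hex with hx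
  have hxk : x ≤ k + 1 := Nat.find_le (Or.inl rfl)
  have hx1 : 1 ≤ x := by
    rcases Nat.find_spec hex with h | h
    · omega
    · exact h.1
  have hlow : lowRoot q T ((k + 1 - x : ℕ) : ℝ) < coth (t / 2) := by
    rcases hxk.eq_or_lt with h | hlt
    · rw [h, Nat.sub_self, Nat.cast_zero, lowRoot_zero]
      exact coth_pos (by positivity)
    · rcases Nat.find_spec hex with h | h
      · omega
      · exact lowRoot_lt_of_le_highRoot_of_mul_tanh_eq hq hq1 hf.pos_length ht hk hroot h.1
          (by omega) h.2 hne'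
  have hhigh (y : ℕ) (hy1 : 1 ≤ y) (hy : y < x) : highRoot q T y < coth (t / 2) :=
    not_le.1 fun h => Nat.find_min hex hy (Or.inr ⟨hy1, h⟩)
  refine normalizedSteklov_lt_of_lowRoot_of_highRoot hf
    (J := (Finset.Icc (-((x - 1 : ℕ) : ℤ)) (x - 1 : ℕ)).erase 0) hlow (fun m hm => ?_) ?_
  · rw [← highRoot_abs, ← Int.cast_abs, ← Int.natCast_natAbs, Int.cast_natCast]
    rw [Finset.mem_erase, Finset.mem_Icc] at hm
    exact hhigh _ (by omega) (by omega)
  · rw [Finset.card_erase_of_mem (by simp), card_Icc_neg]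
    omega

theorem normalizedSteklov_even_eq (hf : IsRotMetric T f) (hk : 2 ≤ k) (ht : 0 < t)
    (hroot : k * Real.tanh (k * t / 2) = coth (t / 2)) (hfT : f 0 = f T) (hT : T = t) :
    normalizedSteklov T f (2 * k) = 4 * Real.pi * coth (t / 2) := by
  subst hT
  have hq := hf.balance_eq_one_iff.2 hfT
  have hlow : lowRoot (balance (f 0) (f T)) T k = coth (T / 2) := by
    rw [hq, lowRoot_one, hroot]
  refine le_antisymm ?_ ?_
  · rw [← hlow]
    exact normalizedSteklov_le_lowRoot hf le_rfl
  · have := lowRoot_le_normalizedSteklov hf (k := 2 * k) (n := k - 1) (J := {0})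
      (fun m hm => ?_) (by rw [Finset.card_singleton]; omega)
    · rwa [Nat.sub_add_cancel (by omega), hlow] at this
    · rw [Nat.sub_add_cancel (by omega), hlow, hq, ← highRoot_abs]
      have hm0 : m ≠ 0 := by simpa using hm
      have h1 : (1 : ℝ) ≤ |(m : ℝ)| := by exact_mod_cast Int.one_le_abs hm0
      have h0 : 0 < |(m : ℝ)| := by linarith
      rw [highRoot_one ht h0]
      have := strictMonoOn_mul_coth.monotoneOn (a := T / 2) (b := |(m : ℝ)| * T / 2)
        (Set.mem_Ioi.2 (by positivity)) (Set.mem_Ioi.2 (by positivity)) (by nlinarith)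
      refine le_of_mul_le_mul_left (a := T / 2) ?_ (by positivity)
      linarith

end Even

/-! ### Index two -/

/-- Wherever the high root of frequency zero falls, the third smallest root is the low root of
frequency `1`: it is double and only `0` and that one high root can precede it. -/
theorem normalizedSteklov_two {T : ℝ} {f : ℝ → ℝ} (hf : IsRotMetric T f) :
    normalizedSteklov T f 2
      = 4 * Real.pi / (coth T + √(coth T ^ 2 - balance (f 0) (f T))) := by
  have hT := hf.pos_length
  obtain ⟨hq, hq1⟩ := hf.balance_mem
  have h1 : lowRoot (balance (f 0) (f T)) T (1 : ℕ)
      = 1 / (coth T + √(coth T ^ 2 - balance (f 0) (f T))) := by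
    rw [lowRoot_eq_div_coth hT (by simp), Nat.cast_one, one_mul]
  rw [div_eq_mul_one_div, ← h1]
  refine le_antisymm (normalizedSteklov_le_lowRoot hf le_rfl) ?_
  refine lowRoot_le_normalizedSteklov hf (n := 0) (J := {0}) (fun m hm => ?_) (by simp)
  have hm0 : m ≠ 0 := by simpa using hm
  have h1 : ((0 + 1 : ℕ) : ℝ) ≤ |(m : ℝ)| := by exact_mod_cast Int.one_le_abs hm0
  rw [← highRoot_abs]
  exact (lowRoot_le_lowRoot hT (by simp) h1).trans (lowRoot_lt_highRoot hq hq1 hT _).le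

theorem normalizedSteklov_two_lt {T : ℝ} {f : ℝ → ℝ} (hf : IsRotMetric T f) :
    normalizedSteklov T f 2 < 4 * Real.pi := by
  have h1 := one_lt_coth hf.pos_length
  have h2 := Real.sqrt_nonneg (coth T ^ 2 - balance (f 0) (f T))
  have hpi := Real.pi_pos
  rw [normalizedSteklov_two hf, div_lt_iff₀ (by linarith)]
  nlinarith

/-! ### Maximizing sequences for index two. -/

theorem tendsto_coth_atTop : Filter.Tendsto coth Filter.atTop (𝓝 1) := by
  have hle : ∀ᶠ x in Filter.atTop, coth x ≤ 1 + x⁻¹ := by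
    filter_upwards [Filter.eventually_gt_atTop 0] with x hx
    have hs := Real.self_lt_sinh_iff.2 hx
    have h1 : Real.cosh x ≤ Real.sinh x + 1 := by
      have h2 := Real.cosh_sub_sinh x
      have h3 : Real.exp (-x) ≤ 1 := Real.exp_le_one_iff.2 (by linarith)
      linarith
    rw [coth, div_le_iff₀ (by linarith)]
    have : 1 ≤ x⁻¹ * Real.sinh x := by
      rw [inv_mul_eq_div, one_le_div hx]
      exact hs.le
    linarith
  refine tendsto_of_tendsto_of_tendsto_of_le_of_le' tendsto_const_nhds
    (by simpa using tendsto_inv_atTop_zero.const_add (1 : ℝ)) ?_ hle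
  filter_upwards [Filter.eventually_gt_atTop 0] with x hx using (one_lt_coth hx).le

theorem tendsto_coth_comp_iff {T : ℕ → ℝ} (hT : ∀ n, 0 < T n) :
    Filter.Tendsto (fun n => coth (T n)) Filter.atTop (𝓝 1)
      ↔ Filter.Tendsto T Filter.atTop Filter.atTop := by
  refine ⟨fun h => Filter.tendsto_atTop.2 fun b => ?_, fun h => tendsto_coth_atTop.comp h⟩
  have hb : 0 < max b 1 := by positivity
  filter_upwards [h.eventually_lt_const (one_lt_coth hb)] with n hn
  exact (le_max_left b 1).trans ((strictAntiOn_coth.lt_iff_gt (hT n) hb).1 hn).le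

theorem tendsto_balance_iff {α β : ℕ → ℝ} (hα : ∀ n, 0 < α n) (hβ : ∀ n, 0 < β n) :
    Filter.Tendsto (fun n => balance (α n) (β n)) Filter.atTop (𝓝 1)
      ↔ Filter.Tendsto (fun n => α n / β n) Filter.atTop (𝓝 1) := by
  constructor
  · intro h
    have h1 : Filter.Tendsto (fun n => ((α n - β n) / (α n + β n)) ^ 2) Filter.atTop (𝓝 0) := by
      have := h.const_sub 1
      simp only [sub_self] at this
      exact this.congr fun n => one_sub_balance (add_pos (hα n) (hβ n)).ne'
    have h2 : Filter.Tendsto (fun n => (α n - β n) / (α n + β n)) Filter.atTop (𝓝 0) := by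
      have h3 := (Real.continuous_sqrt.tendsto 0).comp h1
      rw [Real.sqrt_zero] at h3
      refine (tendsto_zero_iff_abs_tendsto_zero _).2 (h3.congr fun n => ?_)
      simp [Real.sqrt_sq_eq_abs]
    have h4 := (h2.const_add 1).div (h2.const_sub 1) (by simp)
    simp only [add_zero, sub_zero, div_one] at h4
    refine h4.congr fun n => ?_
    have h5 := (hα n).ne'
    have h6 := (hβ n).ne'
    have h7 := (add_pos (hα n) (hβ n)).ne'
    have h8 : 1 - (α n - β n) / (α n + β n) = 2 * β n / (α n + β n) := by
      field_simp
      ring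
    have h9 : 1 + (α n - β n) / (α n + β n) = 2 * α n / (α n + β n) := by
      field_simp
      ring
    simp only [Pi.div_apply, h8, h9]
    field_simp
  · intro h
    have h1 := (h.const_mul 4).div ((h.add_const 1).pow 2) (by norm_num)
    norm_num at h1
    refine h1.congr fun n => ?_
    have h6 := (hβ n).ne'
    have h7 := (add_pos (hα n) (hβ n)).ne'
    have h8 : α n / β n + 1 = (α n + β n) / β n := by field_simp
    simp only [Pi.div_apply, h8, balance]
    field_simp

theorem tendsto_normalizedSteklov_two_iff {T : ℕ → ℝ} {f : ℕ → ℝ → ℝ}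
    (hf : ∀ n, IsRotMetric (T n) (f n)) :
    Filter.Tendsto (fun n => normalizedSteklov (T n) (f n) 2) Filter.atTop (𝓝 (4 * Real.pi)) ↔
      Filter.Tendsto T Filter.atTop Filter.atTop ∧
        Filter.Tendsto (fun n => f n 0 / f n (T n)) Filter.atTop (𝓝 1) := by
  have hT (n : ℕ) := (hf n).pos_length
  rw [← tendsto_coth_comp_iff hT, ← tendsto_balance_iff
    (fun n => (hf n).pos 0 ⟨le_rfl, (hT n).le⟩) (fun n => (hf n).pos (T n) ⟨(hT n).le, le_rfl⟩)]
  simp only [normalizedSteklov_two (hf _)]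
  have hpi : (4 * Real.pi) ≠ 0 := by positivity
  set c : ℕ → ℝ := fun n => coth (T n) with hc
  set q : ℕ → ℝ := fun n => balance (f n 0) (f n (T n)) with hq
  have hc1 (n : ℕ) : 1 < c n := one_lt_coth (hT n)
  have hq1 (n : ℕ) : q n ≤ 1 := (hf n).balance_mem.2
  constructor
  · intro h
    have h1 : Filter.Tendsto (fun n => c n + √(c n ^ 2 - q n)) Filter.atTop (𝓝 1) := by
      have := (tendsto_const_nhds (x := 4 * Real.pi)).div h hpi
      rw [div_self hpi] at this
      refine this.congr fun n => ?_
      rw [Pi.div_apply, div_div_cancel₀ hpi]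
    -- Squeezed between `1` and the full denominator; the square root then tends to zero, which
    -- determines the limit of `q`.
    have hc2 : Filter.Tendsto c Filter.atTop (𝓝 1) :=
      tendsto_of_tendsto_of_tendsto_of_le_of_le tendsto_const_nhds h1 (fun n => (hc1 n).le)
        fun n => le_add_of_nonneg_right (Real.sqrt_nonneg _)
    refine ⟨hc2, ?_⟩
    have h2 := (h1.sub hc2).pow 2
    simp only [add_sub_cancel_left, sub_self] at h2
    have h3 : Filter.Tendsto (fun n => c n ^ 2 - q n) Filter.atTop (𝓝 0) := by
      rw [zero_pow two_ne_zero] at h2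
      refine h2.congr fun n => Real.sq_sqrt ?_
      nlinarith [hc1 n, hq1 n]
    have h4 := (hc2.pow 2).sub h3
    simpa using h4
  · rintro ⟨h1, h2⟩
    have h3 := h1.add ((Real.continuous_sqrt.tendsto _).comp ((h1.pow 2).sub h2))
    have h4 := (tendsto_const_nhds (x := 4 * Real.pi)).div h3 (by simp)
    have h5 : 4 * Real.pi / (1 + √(1 ^ 2 - 1)) = 4 * Real.pi := by simp
    rw [h5] at h4
    exact h4

theorem isLUB_rotSteklovValues_two : IsLUB (rotSteklovValues 2) (4 * Real.pi) := by
  refine isLUB_of_mem_closure ?_ ?_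
  · rintro _ ⟨T, f, hf, rfl⟩
    exact (normalizedSteklov_two_lt hf).le
  · have hf (n : ℕ) : IsRotMetric ((n : ℝ) + 1) fun _ => 1 := isRotMetric_one (by positivity)
    refine mem_closure_of_tendsto ((tendsto_normalizedSteklov_two_iff hf).2 ⟨?_, by simp⟩)
      (Filter.Eventually.of_forall fun n => ⟨_, _, hf n, rfl⟩)
    exact Filter.tendsto_atTop_add_const_right _ _ tendsto_natCast_atTop_atTop

end Steklov

/-! ### Assembly of the three cases. -/

theorem theorem1p1 :
    -- odd indices
    (∃ s₀ : ℝ, (0 < s₀ ∧ s₀ = Steklov.coth s₀) ∧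
      (∀ s : ℝ, 0 < s → s = Steklov.coth s → s = s₀) ∧
      ∀ k : ℕ, 1 ≤ k →
        IsLUB (Steklov.rotSteklovValues (2 * k - 1)) (4 * k * Real.pi / s₀) ∧
        ∀ (T : ℝ) (f : ℝ → ℝ), Steklov.IsRotMetric T f →
          (Steklov.normalizedSteklov T f (2 * k - 1) = 4 * k * Real.pi / s₀ ↔
            f 0 = f T ∧ T = 2 * s₀ / k)) ∧
    -- index two: the supremum, not attained, approached exactly when `T → ∞`, `f(0)/f(T) → 1`
    (IsLUB (Steklov.rotSteklovValues 2) (4 * Real.pi) ∧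
      (∀ (T : ℝ) (f : ℝ → ℝ), Steklov.IsRotMetric T f →
        Steklov.normalizedSteklov T f 2 ≠ 4 * Real.pi) ∧
      ∀ (T : ℕ → ℝ) (f : ℕ → ℝ → ℝ), (∀ n, Steklov.IsRotMetric (T n) (f n)) →
        (Filter.Tendsto (fun n => Steklov.normalizedSteklov (T n) (f n) 2) Filter.atTop
            (𝓝 (4 * Real.pi)) ↔
          Filter.Tendsto T Filter.atTop Filter.atTop ∧
            Filter.Tendsto (fun n => f n 0 / f n (T n)) Filter.atTop (𝓝 1))) ∧
    -- even indices from four on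
    (∀ k : ℕ, 2 ≤ k →
      ∃ s₁ : ℝ, (0 < s₁ ∧ k * Real.tanh (k * s₁ / 2) = Steklov.coth (s₁ / 2)) ∧
        (∀ s : ℝ, 0 < s → k * Real.tanh (k * s / 2) = Steklov.coth (s / 2) → s = s₁) ∧
        IsLUB (Steklov.rotSteklovValues (2 * k))
          (4 * k * Real.pi * Real.tanh (k * s₁ / 2)) ∧
        ∀ (T : ℝ) (f : ℝ → ℝ), Steklov.IsRotMetric T f →
          (Steklov.normalizedSteklov T f (2 * k) =
              4 * k * Real.pi * Real.tanh (k * s₁ / 2) ↔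
            f 0 = f T ∧ T = s₁)) := by
  refine ⟨?_, ⟨Steklov.isLUB_rotSteklovValues_two,
    fun T f hf => (Steklov.normalizedSteklov_two_lt hf).ne,
    fun T f hf => Steklov.tendsto_normalizedSteklov_two_iff hf⟩, ?_⟩
  · obtain ⟨s₀, hs1, hs2, h₀⟩ := Steklov.exists_eq_coth
    have hs0 : 0 < s₀ := by linarith
    refine ⟨s₀, ⟨hs0, h₀⟩, fun s hs h => le_antisymm (Steklov.le_of_le_coth hs hs0 h.le h₀)
      (Steklov.le_of_le_coth hs0 hs h₀.le h), fun k hk => ?_⟩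
    have hk0 : (0 : ℝ) < k := by exact_mod_cast hk
    have hval : 4 * k * Real.pi / s₀ = 4 * Real.pi * (k / s₀) := by ring
    rw [hval]
    have hiff (T : ℝ) (f : ℝ → ℝ) (hf : Steklov.IsRotMetric T f) :
        Steklov.normalizedSteklov T f (2 * k - 1) = 4 * Real.pi * (k / s₀) ↔
          f 0 = f T ∧ T = 2 * s₀ / k :=
      ⟨fun h => by
        by_contra hne
        exact (Steklov.normalizedSteklov_odd_lt hf hs1 hs2 h₀ hk hne).ne h,
        fun h => Steklov.normalizedSteklov_odd_eq hf hs0 h₀ hk h.1 h.2⟩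
    refine ⟨IsGreatest.isLUB ⟨?_, ?_⟩, hiff⟩
    · exact ⟨2 * s₀ / k, fun _ => 1, Steklov.isRotMetric_one (by positivity),
        ((hiff _ _ (Steklov.isRotMetric_one (by positivity))).2 ⟨rfl, rfl⟩).symm⟩
    · rintro _ ⟨T, f, hf, rfl⟩
      by_cases h : f 0 = f T ∧ T = 2 * s₀ / k
      · exact ((hiff T f hf).2 h).le
      · exact (Steklov.normalizedSteklov_odd_lt hf hs1 hs2 h₀ hk h).le
  · intro k hk
    obtain ⟨t, ⟨ht, hroot⟩, huniq⟩ := Steklov.existsUnique_mul_tanh_eq_coth hk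
    refine ⟨t, ⟨ht, hroot⟩, huniq, ?_⟩
    have hval : 4 * k * Real.pi * Real.tanh (k * t / 2) = 4 * Real.pi * Steklov.coth (t / 2) := by
      rw [← hroot]
      ring
    rw [hval]
    have hiff (T : ℝ) (f : ℝ → ℝ) (hf : Steklov.IsRotMetric T f) :
        Steklov.normalizedSteklov T f (2 * k) = 4 * Real.pi * Steklov.coth (t / 2) ↔
          f 0 = f T ∧ T = t :=
      ⟨fun h => by
        by_contra hne
        exact (Steklov.normalizedSteklov_even_lt hf hk ht hroot hne).ne h,
        fun h => Steklov.normalizedSteklov_even_eq hf hk ht hroot h.1 h.2⟩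
    refine ⟨IsGreatest.isLUB ⟨?_, ?_⟩, hiff⟩
    · exact ⟨t, fun _ => 1, Steklov.isRotMetric_one ht,
        ((hiff _ _ (Steklov.isRotMetric_one ht)).2 ⟨rfl, rfl⟩).symm⟩
    · rintro _ ⟨T, f, hf, rfl⟩
      by_cases h : f 0 = f T ∧ T = t
      · exact ((hiff T f hf).2 h).le
      · exact (Steklov.normalizedSteklov_even_lt hf hk ht hroot h).le
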